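/- Let $T_1$ be an infinite, locally finite, one-dimensional rooted metric tree with root $O$, and write $|x|$ for the distance of a point $x\in T_1$ from $O$. Assume that $T_1$ is radial (the length of an edge and the number of edges leaving a vertex away from the root depend only on the generation of the edge, respectively of the vertex) and that its radius $R=\sup_{x\in T_1}|x|$ is finite. Let $g(t)$ be the number of (closed) edges of $T_1$ containing a point $x$ with $|x|=t$. A weight is a positive measurable function on $T_1$; it is symmetric if it depends only on $|x|$; and $f\asymp h$ means that $c^{-1}\le f/h\le c$ on $T_1$ for some constant $c>0$. Let $\rho$ be a symmetric weight with $0<\rho<1$, let $\rho_\alpha\asymp\rho$ and $\rho_\beta\asymp\rho$ be symmetric weights, and let $W\in L^\infty(T_1)$ be real valued. Suppose that there is a constant $C>0$ such that $$C\,g(s)\rho(s)<g(t)\rho(t)\qquad\text{for all } 0\le s\le t<R .$$ Let $C^1_0(T_1)$ be the space of continuous, compactly supported functions $u:T_1\to\mathbb{C}$ which are $C^1$ on each closed edge and which satisfy either the Dirichlet condition $u(O)=0$ or no condition at $O$ (the theorem holds for each of the two choices). Let $H^1_{0,\rho_\beta}(T_1)$ be the completion of $C_0^1(T_1)$ in the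 norm $\big(\int_{T_1}(|u'|^2+|u|^2)\rho_\beta\,d\theta\big)^{1/2}$, and put $$E(u,v)=\int_{T_1}\Big(\frac{\rho_\alpha}{\rho_\beta}\,u'\,\overline{v}'+W\,u\,\overline{v}\Big)\rho_\beta\,d\theta ,\qquad u,v\in H^1_{0,\rho_\beta}(T_1).$$ Then there is a unique operator $\overline L_{\alpha,\beta}$ in $L_{2,\rho_\beta}(T_1)$, formally $u\mapsto-\rho_\beta^{-1}(\rho_\alpha u')'+Wu$, such that $u\in\mathrm{Dom}(\overline L_{\alpha,\beta})$ and $\overline L_{\alpha,\beta}u=f$ if and only if $u\in H^1_{0,\rho_\beta}(T_1)$ and $E(u,v)=\int_{T_1} f\,\overline v\,\rho_\beta\,d\theta$ for all $v\in H^1_{0,\rho_\beta}(T_1)$. This operator is self-adjoint, and its spectrum is purely discrete: every point of the spectrum is isolated in the spectrum and is an eigenvalue of finite multiplicity. -/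

import Mathlib

open MeasureTheory Topology Set

noncomputable section

/-- A locally finite rooted metric tree: a rooted tree (`⊥` is the root, `Order.pred v` the parent
of `v`) in which every vertex `v ≠ ⊥` carries the length of the edge joining it to its parent. -/
structure MetricTree extends RootedTree where
  length : α → ℝ
  length_pos : ∀ v, v ≠ ⊥ → 0 < length v
  finite_children : ∀ v : α, {w | v ⋖ w}.Finite

namespace MetricTree

variable (T : MetricTree)

/-- The vertices. -/
abbrev Vertex : Type _ := T.toRootedTree

/-- An edge is named by its endpoint farther from the root. -/
abbrev Edge : Type _ := {v : T.Vertex // v ≠ ⊥}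

/-- The generation of a vertex: the number of edges joining it to the root. -/
def gen (v : T.Vertex) : ℕ := sInf {n | Order.pred^[n] v = ⊥}

/-- The degree `k(v)`: the number of edges joining `v` to vertices of the next generation. -/
def degree (v : T.Vertex) : ℕ := {w : T.Vertex | v ⋖ w}.ncard

/-- The distance of a vertex from the root. -/
def height (v : T.Vertex) : ℝ := ∑ i ∈ Finset.range (T.gen v), T.length (Order.pred^[i] v)

theorem gen_bot : T.gen ⊥ = 0 := by
  have h : (0 : ℕ) ∈ {n | Order.pred^[n] (⊥ : T.Vertex) = ⊥} := by simp
  exact Nat.le_zero.mp (Nat.sInf_le h)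

theorem height_bot : T.height ⊥ = 0 := by
  simp [height, gen_bot]

theorem gen_of_ne_bot (v : T.Vertex) (hv : v ≠ ⊥) : T.gen v = T.gen (Order.pred v) + 1 := by
  have hne : {n | Order.pred^[n] v = ⊥}.Nonempty :=
    (bot_le (a := v)).exists_pred_iterate
  have hpos : T.gen v ≠ 0 := by
    intro h0
    have h1 : Order.pred^[T.gen v] v = ⊥ := Nat.sInf_mem hne
    rw [h0] at h1
    exact hv h1
  have hne' : {n | Order.pred^[n] (Order.pred v) = ⊥}.Nonempty :=
    (bot_le (a := Order.pred v)).exists_pred_iterate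
  apply le_antisymm
  · apply Nat.sInf_le
    have h1 : Order.pred^[T.gen (Order.pred v)] (Order.pred v) = ⊥ := Nat.sInf_mem hne'
    simpa using h1
  · have h1 : Order.pred^[T.gen v] v = ⊥ := Nat.sInf_mem hne
    obtain ⟨m, hm⟩ := Nat.exists_eq_succ_of_ne_zero hpos
    rw [hm] at h1 ⊢
    have h2 : T.gen (Order.pred v) ≤ m := Nat.sInf_le (by simpa using h1)
    omega

theorem height_of_ne_bot (v : T.Vertex) (hv : v ≠ ⊥) :
    T.height v = T.height (Order.pred v) + T.length v := by
  unfold height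
  rw [T.gen_of_ne_bot v hv, Finset.sum_range_succ']
  simp

theorem height_pred_lt (v : T.Vertex) (hv : v ≠ ⊥) : T.height (Order.pred v) < T.height v := by
  have h1 := T.height_of_ne_bot v hv
  have h2 := T.length_pos v hv
  linarith

/-- A tree is radial if edge lengths and degrees depend only on the generation. (An edge has the
generation of its upper endpoint, so edges of equal generation are those whose lower endpoints
have equal generation.) -/
def IsRadial : Prop :=
  (∀ v w : T.Edge, T.gen v.1 = T.gen w.1 → T.length v.1 = T.length w.1) ∧
    ∀ v w : T.Vertex, T.gen v = T.gen w → T.degree v = T.degree w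

/-- The points of the metric tree. The edge ending at `v` contributes its half-open part, which
excludes the parent of `v`, so that every point is listed once; a point is given by the
edge on which it lies and by its distance `abs` from the root. The root itself is `⟨⊥, 0⟩`. -/
@[ext]
structure Point where
  top : T.Vertex
  abs : ℝ
  le_height : abs ≤ T.height top
  lt_abs : T.height (Order.pred top) < abs ∨ (top = ⊥ ∧ abs = 0)

/-- A vertex as a point of the tree. -/
def vertexPoint (v : T.Vertex) : T.Point where
  top := v
  abs := T.height v
  le_height := le_rfl
  lt_abs := by
    by_cases hv : v = ⊥
    · right
      exact ⟨hv, by rw [hv, T.height_bot]⟩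
    · left
      exact T.height_pred_lt v hv

/-- The distances from the root of the two endpoints of an edge. -/
def lo (e : T.Edge) : ℝ := T.height (Order.pred e.1)

/-- See `lo`. -/
def hi (e : T.Edge) : ℝ := T.height e.1

/-- The arc-length parametrization of an edge by the distance from the root, `lo e ≤ t ≤ hi e`
(constant outside this interval). -/
def edgePoint (e : T.Edge) (t : ℝ) : T.Point :=
  if h : t ≤ T.lo e then T.vertexPoint (Order.pred e.1)
  else
    { top := e.1
      abs := min t (T.hi e)
      le_height := min_le_right _ _
      lt_abs := Or.inl (lt_min (not_le.mp h) (T.height_pred_lt e.1 e.2)) }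

theorem edgePoint_abs (e : T.Edge) (t : ℝ) (ht : t ∈ Icc (T.lo e) (T.hi e)) :
    (T.edgePoint e t).abs = t := by
  unfold edgePoint
  split_ifs with h
  · exact le_antisymm ht.1 h
  · exact min_eq_left ht.2

/-- A closed edge as a set of points. -/
def edgeSet (e : T.Edge) : Set T.Point := T.edgePoint e '' Icc (T.lo e) (T.hi e)

/-- The counting function: the number of edges which contain a point at distance `t` from the
root. -/
def counting (t : ℝ) : ℕ := {e : T.Edge | ∃ x ∈ T.edgeSet e, x.abs = t}.ncard

/-- The radius of the tree. -/
def radius : ENNReal := ⨆ x : T.Point, ENNReal.ofReal x.abs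

/-- A set of points is measurable if its trace on each edge is. -/
instance instMeasurableSpacePoint : MeasurableSpace T.Point :=
  ⨅ e : T.Edge, MeasurableSpace.map (T.edgePoint e) inferInstance

theorem measurable_edgePoint (e : T.Edge) : Measurable (T.edgePoint e) := by
  rw [measurable_iff_le_map]
  exact iInf_le _ e

/-- The length measure on the tree. -/
def lengthMeasure : Measure T.Point :=
  Measure.sum fun e : T.Edge =>
    (volume.restrict (Icc (T.lo e) (T.hi e))).map (T.edgePoint e)

variable {T}

/-- A weight function. -/
def IsWeight (ρ : T.Point → ℝ) : Prop := Measurable ρ ∧ ∀ x, 0 < ρ x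

/-- A function on the tree is symmetric if it depends only on the distance from the root. -/
def IsSymmetric (f : T.Point → ℝ) : Prop := ∀ x y, x.abs = y.abs → f x = f y

/-- The relation `f ≍ g` between positive functions. -/
def Comparable (f g : T.Point → ℝ) : Prop :=
  ∃ c : ℝ, 0 < c ∧ ∀ x, c⁻¹ ≤ f x / g x ∧ f x / g x ≤ c

/-- The measure `ρ dθ` on the tree. -/
def weighted (ρ : T.Point → ℝ) : Measure T.Point :=
  T.lengthMeasure.withDensity fun x => ENNReal.ofReal (ρ x)

/-- The weighted space `L_{2,ρ}`. -/
abbrev L2 (ρ : T.Point → ℝ) : Type _ := Lp ℂ 2 (weighted ρ)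

/-- The derivative of a function along the edges, in the direction away from the root (relevant
only in the interior of the edges). -/
def edgeDeriv (u : T.Point → ℂ) (x : T.Point) : ℂ :=
  open Classical in
  if h : x.top ≠ ⊥ then deriv (fun t => u (T.edgePoint ⟨x.top, h⟩ t)) x.abs else 0

/-- Boundary condition at the root. -/
inductive RootCondition
  | dirichlet
  | free

/-- The space `C^1_0`: functions which are `C^1` on every closed edge (hence continuous on the
tree, since edges share their endpoints), vanish off finitely many edges (that is, have compact
support) and, for the Dirichlet condition, vanish at the root. -/
structure IsTest (bc : RootCondition) (u : T.Point → ℂ) : Prop where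
  contDiffOn : ∀ e : T.Edge,
    ContDiffOn ℝ 1 (fun t => u (T.edgePoint e t)) (Icc (T.lo e) (T.hi e))
  compact_support : ∃ F : Set T.Edge, F.Finite ∧ ∀ x, (∀ e ∈ F, x ∉ T.edgeSet e) → u x = 0
  root : bc = RootCondition.dirichlet → u (T.vertexPoint ⊥) = 0

/-- The space `H^1_{0,ρ}`: the completion of `C^1_0` in the norm
`(∫ (|u'|² + |u|²) ρ)^{1/2}`, realized as the closure of the pairs `(u, u')` in
`L_{2,ρ} × L_{2,ρ}`. -/
def H10 (bc : RootCondition) (ρ : T.Point → ℝ) : Submodule ℂ (L2 ρ × L2 ρ) :=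
  (Submodule.span ℂ {p : L2 ρ × L2 ρ | ∃ u : T.Point → ℂ, IsTest bc u ∧
    p.1 =ᵐ[weighted ρ] u ∧ p.2 =ᵐ[weighted ρ] edgeDeriv u}).topologicalClosure

/-- The form `E(u,v) = ∫ ((ρα / ρβ) u' v̄' + W u v̄) ρβ`, for `p = (u, u')` and `q = (v, v')`. -/
def form (ρα ρβ W : T.Point → ℝ) (p q : L2 ρβ × L2 ρβ) : ℂ :=
  ∫ x, ((ρα x / ρβ x : ℝ) : ℂ) * p.2 x * (starRingEnd ℂ) (q.2 x)
    + (W x : ℂ) * p.1 x * (starRingEnd ℂ) (q.1 x) ∂(weighted ρβ)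

/-- `A` is the operator of the form `E` on `H^1_{0,ρβ}`: `u` is in its domain and `A u = f` if and
only if `u` is in the form domain and `E(u,v) = ∫ f v̄ ρβ` for all `v` in the form domain. This
determines `A`. -/
def IsWidthWeightedOperator (bc : RootCondition) (ρα ρβ W : T.Point → ℝ)
    (A : L2 ρβ →ₗ.[ℂ] L2 ρβ) : Prop :=
  ∀ u f : L2 ρβ, (u, f) ∈ A.graph ↔
    ∃ p ∈ H10 bc ρβ, p.1 = u ∧ ∀ q ∈ H10 bc ρβ, form ρα ρβ W p q = inner ℂ q.1 f

end MetricTree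

namespace UnboundedOperator

variable {H : Type*} [NormedAddCommGroup H] [InnerProductSpace ℂ H]

/-- The operator `A - z` on the domain of `A`. -/
def shift (A : H →ₗ.[ℂ] H) (z : ℂ) : A.domain →ₗ[ℂ] H := A.toFun - z • A.domain.subtype

/-- The spectrum: the `z` for which `A - z` is not a bijection of the domain of `A` onto `H` with
bounded inverse. -/
def spectrum (A : H →ₗ.[ℂ] H) : Set ℂ :=
  {z | ¬ (Function.Bijective (shift A z) ∧
    ∃ C : ℝ, ∀ u : A.domain, ‖(u : H)‖ ≤ C * ‖shift A z u‖)}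

/-- The spectrum is purely discrete: each of its points is isolated in it and is an eigenvalue of
finite multiplicity. -/
def HasPurelyDiscreteSpectrum (A : H →ₗ.[ℂ] H) : Prop :=
  ∀ z ∈ spectrum A, (∃ U ∈ 𝓝 z, U ∩ spectrum A = {z}) ∧
    LinearMap.ker (shift A z) ≠ ⊥ ∧ FiniteDimensional ℂ (LinearMap.ker (shift A z))

end UnboundedOperator

end

/-! The form `E` is bounded, symmetric and bounded below on the Hilbert space `H10'`, because `ρα /
ρβ` lies between positive constants and `W` is bounded. Everything therefore rests on compactness of
the embedding `P` of `H10'` into `L2 ρβ`. If `D` is the form operator made coercive by adding `l P*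
P`, then `K = P D⁻¹ P*` is compact, symmetric and injective, and the required operator is `K⁻¹ - l`
(`exists_operator_of_form`, `exists_selfAdjoint_of_compact_resolvent`).

For compactness it suffices to approximate test functions by finite-dimensional spaces, uniformly in
terms of their energy (`exists_finiteDimensional_approx`). Fix `R` above all heights. Along an edge,
Cauchy-Schwarz gives `|u(s)|²/(R-s) ≤ |u(r)|²/(R-r) + ∫ |u'|²` over `(s, r)` (`enorm_sq_div_le`). In
a radial tree the vertices of one generation have equally many children, so averages over
generations telescope away from the root until the support of `u` ends (`IsTest.average_le`). The
growth of `g ρ` turns these averages into weighted energies: on each sphere avoiding the vertices,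
the weighted sum of `|u|²` is at most `R K` times the energy (`IsTest.sphere_le`).

Integrating over the distance from the root bounds the mass beyond generation `N` by the remaining
height, which tends to zero because the radius is finite (`exists_tail_le`). On each of the finitely
many remaining edges the weight is bounded below, so `u` is close to a step function whose mesh does
not depend on `u` (`IsGrowing.exists_step_le`). -/

section Abstract

/-! ### Compact resolvents and operators defined by forms. -/

variable {H V : Type*} [NormedAddCommGroup H] [InnerProductSpace ℂ H]
  [NormedAddCommGroup V] [InnerProductSpace ℂ V]

/-- A symmetric coercive operator on a Hilbert space is bijective. -/
theorem bijective_of_coercive [CompleteSpace V] (B : V →L[ℂ] V)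
    (hB : ∀ x y, inner ℂ (B x) y = inner ℂ x (B y))
    {c : ℝ} (hc : 0 < c) (h : ∀ x, c * ‖x‖ ^ 2 ≤ (inner ℂ x (B x)).re) :
    Function.Bijective B := by
  have hbelow : ∀ x, c * ‖x‖ ≤ ‖B x‖ := by
    intro x
    rcases eq_or_ne x 0 with rfl | hx
    · simp
    · have h1 := (h x).trans ((Complex.re_le_norm _).trans (norm_inner_le_norm x (B x)))
      have h2 : 0 < ‖x‖ := norm_pos_iff.mpr hx
      nlinarith
  have hanti : AntilipschitzWith (c⁻¹).toNNReal B := by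
    refine ContinuousLinearMap.antilipschitz_of_bound B fun x => ?_
    rw [Real.coe_toNNReal _ (inv_nonneg.mpr hc.le), inv_mul_eq_div, le_div_iff₀ hc, mul_comm]
    exact hbelow x
  refine ⟨hanti.injective, ?_⟩
  have hcl : IsClosed (B.range : Set V) := hanti.isClosed_range B.uniformContinuous
  have := hcl.completeSpace_coe
  have htop : B.range = ⊤ := by
    -- The range is closed, so it is enough that its orthogonal complement vanishes: a vector `w` in
    -- it satisfies `⟪B w, w⟫ = 0`, which coercivity excludes unless `w = 0`.
    rw [← B.range.orthogonal_orthogonal, Submodule.eq_top_iff']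
    intro v w hw
    have h0 : inner ℂ (B w) w = 0 := hw _ ⟨w, rfl⟩
    have h1 := h w
    rw [← hB, h0] at h1
    have h2 : ‖w‖ ^ 2 ≤ 0 := by
      by_contra h3
      push Not at h3
      have := mul_pos hc h3
      simp at h1
      linarith
    have : w = 0 := by
      have := le_antisymm h2 (by positivity)
      simpa using this
    simp [this]
  exact LinearMap.range_eq_top.mp htop

/-- The eigenvalues of a compact symmetric operator accumulate only at zero. -/
theorem finite_eigenvalues_ge (K : H →L[ℂ] H) (hK : IsCompactOperator K)
    (hs : (K : H →ₗ[ℂ] H).IsSymmetric) {ε : ℝ} (hε : 0 < ε) :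
    {μ : ℂ | Module.End.HasEigenvalue (K : H →ₗ[ℂ] H) μ ∧ ε ≤ ‖μ‖}.Finite := by
  by_contra hinf
  obtain ⟨f, hf⟩ := Set.Infinite.natEmbedding _ hinf
  have hev : ∀ n, ∃ v : H, ‖v‖ = 1 ∧ K v = (f n : ℂ) • v := by
    intro n
    obtain ⟨v, hv⟩ := (f n).2.1.exists_hasEigenvector
    have hv0 : ‖v‖ ≠ 0 := norm_ne_zero_iff.mpr hv.2
    refine ⟨((‖v‖ : ℂ)⁻¹) • v, ?_, ?_⟩
    · rw [norm_smul]; simp [hv0]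
    · rw [map_smul, smul_comm]
      congr 1
      exact hv.apply_eq_smul
  choose v hv1 hv2 using hev
  have horth : ∀ m n, m ≠ n → inner ℂ (v m) (v n) = 0 := by
    intro m n hmn
    have hne : (f m : ℂ) ≠ f n := fun h => hmn (hf (Subtype.ext h))
    have := hs.orthogonalFamily_eigenspaces hne
      ⟨v m, Module.End.mem_eigenspace_iff.mpr (hv2 m)⟩
      ⟨v n, Module.End.mem_eigenspace_iff.mpr (hv2 n)⟩
    simpa using this
  -- The images `K (v n)` are orthogonal of norm at least `ε`, hence at least `ε` apart, so no
  -- subsequence of them is Cauchy.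
  obtain ⟨C, hC, hKC⟩ := hK.image_closedBall_subset_compact (f := (K : H →ₗ[ℂ] H)) 1
  have hmem : ∀ n, K (v n) ∈ C := fun n => hKC ⟨v n, by simp [hv1], rfl⟩
  obtain ⟨a, -, φ, hφ, hlim⟩ := hC.tendsto_subseq hmem
  have hcau := hlim.cauchySeq
  obtain ⟨N, hN⟩ := Metric.cauchySeq_iff.mp hcau ε hε
  have h1 := hN N le_rfl (N + 1) (Nat.le_succ N)
  have hne : φ N ≠ φ (N + 1) := (hφ (Nat.lt_succ_self N)).ne
  set m := φ N
  set n := φ (N + 1)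
  have h2 : ‖K (v m) - K (v n)‖ ^ 2 = ‖K (v m)‖ ^ 2 + ‖K (v n)‖ ^ 2 := by
    have := norm_sub_sq (𝕜 := ℂ) (K (v m)) (K (v n))
    rw [this, hv2 m, hv2 n, inner_smul_left, inner_smul_right, horth m n hne]
    simp
  have h3 : ε ≤ ‖K (v m)‖ := by rw [hv2, norm_smul, hv1, mul_one]; exact (f m).2.2
  rw [Function.comp_apply, Function.comp_apply, dist_eq_norm] at h1
  have h4 : 0 ≤ ‖K (v m) - K (v n)‖ := norm_nonneg _
  nlinarith [sq_nonneg ‖K (v n)‖]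

open UnboundedOperator in
/-- If `K` is compact, symmetric and injective, then `K⁻¹ - l` is self-adjoint with purely
discrete spectrum. -/
theorem exists_selfAdjoint_of_compact_resolvent [CompleteSpace H] (K : H →L[ℂ] H)
    (hK : IsCompactOperator K)
    (hs : (K : H →ₗ[ℂ] H).IsSymmetric) (hinj : Function.Injective K) (l : ℝ) :
    ∃ A : H →ₗ.[ℂ] H, (∀ u f, (u, f) ∈ A.graph ↔ u = K (f + (l : ℂ) • u)) ∧
      IsSelfAdjoint A ∧ HasPurelyDiscreteSpectrum A := by
  -- The graph of `K⁻¹ - l`, written without an inverse.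
  let G : Submodule ℂ (H × H) :=
    { carrier := {p | p.1 = K (p.2 + (l : ℂ) • p.1)}
      add_mem' := by
        intro a b ha hb
        simp only [mem_ofPred_eq, Prod.fst_add, Prod.snd_add] at ha hb ⊢
        conv_lhs => rw [ha, hb]
        rw [← map_add]; congr 1; rw [smul_add]; abel
      zero_mem' := by simp
      smul_mem' := by
        intro c a ha
        simp only [mem_ofPred_eq, Prod.smul_fst, Prod.smul_snd] at ha ⊢
        conv_lhs => rw [ha]
        rw [← map_smul]; congr 1; rw [smul_add, smul_comm] }
  have hGmem : ∀ u f, (u, f) ∈ G ↔ u = K (f + (l : ℂ) • u) := fun u f => Iff.rfl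
  have hG : ∀ x ∈ G, x.1 = 0 → x.2 = 0 := by
    rintro ⟨u, f⟩ hx (rfl : u = 0)
    rw [hGmem] at hx
    apply hinj
    simpa using hx.symm
  have hgraph : G.toLinearPMap.graph = G := Submodule.toLinearPMap_graph_eq G hG
  set A := G.toLinearPMap with hA
  have hAG : ∀ u f, (u, f) ∈ A.graph ↔ u = K (f + (l : ℂ) • u) := by
    intro u f; rw [hgraph, hGmem]
  have hdom : ∀ f, K f ∈ A.domain := by
    intro f
    have : (K f, f - (l : ℂ) • K f) ∈ A.graph := by rw [hAG]; simp
    exact LinearPMap.mem_domain_of_mem_graph this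
  have hAK : ∀ f, A ⟨K f, hdom f⟩ = f - (l : ℂ) • K f := by
    intro f
    have h1 : (K f, f - (l : ℂ) • K f) ∈ A.graph := by rw [hAG]; simp
    have h2 := A.mem_graph ⟨K f, hdom f⟩
    exact LinearPMap.mem_graph_snd_inj A h2 h1 rfl
  have hdomK : ∀ u : A.domain, ∃ f, u = ⟨K f, hdom f⟩ := by
    intro u
    have h1 := A.mem_graph u
    rw [hAG] at h1
    exact ⟨_, Subtype.ext h1⟩
  have hdense : Dense (A.domain : Set H) := by
    have h1 : (K.range : Submodule ℂ H) ≤ A.domain := by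
      rintro _ ⟨f, rfl⟩; exact hdom f
    have h2 : Dense (K.range : Set H) := by
      rw [Submodule.dense_iff_topologicalClosure_eq_top, Submodule.topologicalClosure_eq_top_iff,
        Submodule.eq_bot_iff]
      intro w hw
      apply hinj
      rw [map_zero]
      -- For `w` orthogonal to the range, symmetry turns this into `‖K w‖² = 0`; injectivity of `K`
      -- then gives density of the domain.
      have h3 : inner ℂ (K (K w)) w = 0 := hw _ ⟨K w, rfl⟩
      have h4 : inner ℂ (K (K w)) w = inner ℂ (K w) (K w) := hs (K w) w
      rw [h4] at h3
      exact inner_self_eq_zero.mp h3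
    exact h2.mono h1
  have hshift : ∀ (z : ℂ) (f : H), shift A z ⟨K f, hdom f⟩ = f - ((l : ℂ) + z) • K f := by
    intro z f
    have : shift A z ⟨K f, hdom f⟩ = A ⟨K f, hdom f⟩ - z • K f := rfl
    rw [this, hAK, add_smul, sub_sub]
  -- a nonzero point of the spectrum gives an eigenvalue of `K`
  have hspec : ∀ z ∈ UnboundedOperator.spectrum A, (l : ℂ) + z ≠ 0 ∧
      Module.End.HasEigenvalue (K : H →ₗ[ℂ] H) ((l : ℂ) + z)⁻¹ := by
    intro z hz
    -- At `z = -l` the shifted operator is `K⁻¹`, with bounded inverse `K`.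
    have hw : (l : ℂ) + z ≠ 0 := by
      intro h0
      apply hz
      refine ⟨⟨?_, ?_⟩, ‖K‖, ?_⟩
      · intro u v huv
        obtain ⟨f, rfl⟩ := hdomK u
        obtain ⟨g, rfl⟩ := hdomK v
        rw [hshift, hshift, h0] at huv
        simp at huv
        simp [huv]
      · intro f
        exact ⟨⟨K f, hdom f⟩, by rw [hshift, h0]; simp⟩
      · intro u
        obtain ⟨f, rfl⟩ := hdomK u
        rw [hshift, h0]
        simpa using K.le_opNorm f
    refine ⟨hw, ?_⟩
    -- Fredholm alternative at `w⁻¹`, where `w = l + z`. In the resolvent case `S = w⁻¹ - K` is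
    -- invertible and `A - z` sends `K f` to `w • S f`, so its inverse is `K S⁻¹ w⁻¹`, which is
    -- bounded.
    rcases hK.hasEigenvalue_or_mem_resolventSet (inv_ne_zero hw) with h | h
    · exact h
    exfalso
    apply hz
    set w := (l : ℂ) + z
    obtain ⟨S, hS⟩ := (spectrum.mem_resolventSet_iff.mp h)
    have hSf : ∀ f, (S : H →L[ℂ] H) f = w⁻¹ • (f - w • K f) := by
      intro f
      rw [hS, smul_sub, smul_smul, inv_mul_cancel₀ hw, one_smul]
      simp [Algebra.algebraMap_eq_smul_one]
    have hSS : ∀ f, ((S⁻¹ : (H →L[ℂ] H)ˣ) : H →L[ℂ] H) ((S : H →L[ℂ] H) f) = f := by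
      intro f
      rw [← mul_apply_eq_comp, Units.inv_mul, one_apply_eq_self]
    have hSS' : ∀ f, (S : H →L[ℂ] H) (((S⁻¹ : (H →L[ℂ] H)ˣ) : H →L[ℂ] H) f) = f := by
      intro f
      rw [← mul_apply_eq_comp, Units.mul_inv, one_apply_eq_self]
    have hSf' : ∀ f, shift A z ⟨K f, hdom f⟩ = w • (S : H →L[ℂ] H) f := by
      intro f
      rw [hshift, hSf, smul_smul, mul_inv_cancel₀ hw, one_smul]
    refine ⟨⟨?_, ?_⟩, ‖K‖ * (‖((S⁻¹ : (H →L[ℂ] H)ˣ) : H →L[ℂ] H)‖ * ‖w⁻¹‖), ?_⟩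
    · intro u v huv
      obtain ⟨f, rfl⟩ := hdomK u
      obtain ⟨g, rfl⟩ := hdomK v
      rw [hSf', hSf'] at huv
      have h1 := smul_right_injective H hw huv
      have h2 : f = g := by rw [← hSS f, h1, hSS]
      simp [h2]
    · intro f
      refine ⟨⟨K (((S⁻¹ : (H →L[ℂ] H)ˣ) : H →L[ℂ] H) (w⁻¹ • f)), hdom _⟩, ?_⟩
      rw [hSf', hSS', smul_smul, mul_inv_cancel₀ hw, one_smul]
    · intro u
      obtain ⟨f, rfl⟩ := hdomK u
      rw [hSf', norm_smul]
      calc ‖K f‖ ≤ ‖K‖ * ‖f‖ := K.le_opNorm f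
        _ ≤ ‖K‖ * (‖((S⁻¹ : (H →L[ℂ] H)ˣ) : H →L[ℂ] H)‖ * ‖(S : H →L[ℂ] H) f‖) := by
            gcongr
            conv_lhs => rw [← hSS f]
            exact ContinuousLinearMap.le_opNorm _ _
        _ = _ := by
            rw [norm_inv]
            have : ‖w‖ ≠ 0 := norm_ne_zero_iff.mpr hw
            field_simp
  refine ⟨A, hAG, ?_, ?_⟩
  · rw [LinearPMap.isSelfAdjoint_def]
    apply LinearPMap.eq_of_eq_graph
    rw [LinearPMap.adjoint_graph_eq_graph_adjoint hdense]
    ext ⟨x, y⟩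
    rw [Submodule.mem_adjoint_iff, hAG]
    -- The pair `(x, y)` is in the graph of the adjoint when the left side vanishes for all `f`; the
    -- right side shows that this is the equation defining the graph of `A`.
    have key : ∀ f, inner ℂ (f - (l : ℂ) • K f) x - inner ℂ (K f) y
        = inner ℂ f (x - K (y + (l : ℂ) • x)) := by
      intro f
      have h1 : inner ℂ (K f) y = inner ℂ f (K y) := hs f y
      have h2 : inner ℂ (K f) x = inner ℂ f (K x) := hs f x
      simp only [inner_sub_left, inner_sub_right, inner_smul_left, inner_smul_right, map_add,
        map_smul, inner_add_right, h1, h2, Complex.conj_ofReal]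
      ring
    constructor
    · intro h
      have h1 : ∀ f, inner ℂ f (x - K (y + (l : ℂ) • x)) = 0 := by
        intro f
        rw [← key]
        apply h
        rw [hAG]; simp
      exact sub_eq_zero.mp (inner_self_eq_zero.mp (h1 _))
    · intro h a b hab
      rw [hAG] at hab
      have h1 := key (b + (l : ℂ) • a)
      rw [← hab, ← h, sub_self, inner_zero_right, add_sub_cancel_right] at h1
      exact h1
  · intro z hz
    obtain ⟨hw, hev⟩ := hspec z hz
    have hker : ∀ u : A.domain, u ∈ LinearMap.ker (shift A z) ↔
        (u : H) ∈ Module.End.eigenspace (K : H →ₗ[ℂ] H) ((l : ℂ) + z)⁻¹ := by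
      intro u
      obtain ⟨f, rfl⟩ := hdomK u
      rw [LinearMap.mem_ker, hshift, Module.End.mem_eigenspace_iff, sub_eq_zero]
      constructor
      · intro h
        have : K (K f) = ((l : ℂ) + z)⁻¹ • K f := by
          conv_rhs => rw [h]
          rw [map_smul, smul_smul, inv_mul_cancel₀ hw, one_smul]
        exact this
      · intro h
        have h' : K (K f) = ((l : ℂ) + z)⁻¹ • K f := h
        rw [← map_smul] at h'
        rw [hinj h', smul_smul, mul_inv_cancel₀ hw, one_smul]
    refine ⟨?_, ?_, ?_⟩
    -- For `z'` within distance 1 of `z`, `|l + z'| ≤ r`, so spectral points there yield eigenvalues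
    -- of `K` of modulus at least `r⁻¹`, of which there are finitely many.
    · set r := ‖(l : ℂ) + z‖ + 1
      have hr : 0 < r := by positivity
      have hfin := finite_eigenvalues_ge K hK hs (inv_pos.mpr hr)
      have hfin2 : (UnboundedOperator.spectrum A ∩ Metric.ball z 1).Finite := by
        refine (hfin.preimage (f := fun z' : ℂ => ((l : ℂ) + z')⁻¹) ?_).subset ?_
        · intro a _ b _ hab
          simpa using hab
        · rintro z' ⟨h1, h2⟩
          obtain ⟨h3, h4⟩ := hspec z' h1
          refine ⟨h4, ?_⟩
          rw [norm_inv]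
          apply inv_anti₀ (norm_pos_iff.mpr h3)
          have : (l : ℂ) + z' = ((l : ℂ) + z) + (z' - z) := by ring
          rw [this]
          refine (norm_add_le _ _).trans ?_
          have := mem_ball_iff_norm.mp h2
          simp only [r]
          linarith
      refine ⟨Metric.ball z 1 ∩ ((UnboundedOperator.spectrum A ∩ Metric.ball z 1) \ {z})ᶜ,
        Filter.inter_mem (Metric.ball_mem_nhds z one_pos)
          ((hfin2.subset sdiff_subset).isClosed.isOpen_compl.mem_nhds (by simp)), ?_⟩
      ext y
      simp only [mem_inter_iff, mem_compl_iff, mem_sdiff, mem_singleton_iff]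
      constructor
      · rintro ⟨⟨h1, h2⟩, h3⟩
        by_contra h4
        exact h2 ⟨⟨h3, h1⟩, h4⟩
      · rintro rfl
        exact ⟨⟨Metric.mem_ball_self one_pos, by simp⟩, hz⟩
    · obtain ⟨v, hv⟩ := hev.exists_hasEigenvector
      rw [Submodule.ne_bot_iff]
      have hvK : v = K (((l : ℂ) + z) • v) := by
        have h1 : K v = ((l : ℂ) + z)⁻¹ • v := hv.apply_eq_smul
        rw [map_smul, h1, smul_smul, mul_inv_cancel₀ hw, one_smul]
      have hvd : v ∈ A.domain := by rw [hvK]; exact hdom _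
      refine ⟨⟨v, hvd⟩, (hker _).mpr hv.1, ?_⟩
      intro h
      exact hv.2 (congrArg Subtype.val h)
    · have hfd : FiniteDimensional ℂ
          (Module.End.eigenspace (K : H →ₗ[ℂ] H) ((l : ℂ) + z)⁻¹) := by
        exact ContinuousLinearMap.finite_dimensional_eigenspace hK _ (inv_ne_zero hw)
      let φ : LinearMap.ker (shift A z) →ₗ[ℂ]
          Module.End.eigenspace (K : H →ₗ[ℂ] H) ((l : ℂ) + z)⁻¹ :=
        LinearMap.codRestrict _ (A.domain.subtype ∘ₗ (LinearMap.ker (shift A z)).subtype)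
          fun u => (hker u.1).mp u.2
      refine Module.Finite.of_injective φ ?_
      intro u v huv
      have h := congrArg (Submodule.subtype _) huv
      exact Subtype.ext (Subtype.ext h)

/-- An operator approximable by finite-dimensional subspaces is compact. -/
theorem isCompactOperator_of_finiteDimensional_approx [CompleteSpace H] (P : V →L[ℂ] H)
    (h : ∀ ε : ℝ, 0 < ε → ∃ F : Submodule ℂ H, FiniteDimensional ℂ F ∧
      ∀ p, ∃ f ∈ F, ‖P p - f‖ ≤ ε * ‖p‖) : IsCompactOperator P := by
  have hmem : P ∈ closure {f : V →L[ℂ] H | IsCompactOperator f} := by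
    rw [Metric.mem_closure_iff]
    intro ε hε
    obtain ⟨F, hF, hFP⟩ := h (ε / 2) (by positivity)
    -- The given approximants need not depend linearly on `p`; the orthogonal projection onto `F`
    -- does, and it is at least as good.
    refine ⟨F.starProjection ∘L P, ?_, ?_⟩
    · have h1 : IsCompactOperator (F.subtypeL ∘ (F.orthogonalProjectionOnto ∘ P)) := by
        have : IsCompactOperator (F.orthogonalProjectionOnto ∘L P) :=
          (isCompactOperator_id (E := F)).comp_clm (F.orthogonalProjectionOnto ∘L P)
        exact this.clm_comp F.subtypeL
      exact h1
    · rw [dist_eq_norm]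
      refine lt_of_le_of_lt (ContinuousLinearMap.opNorm_le_bound _ (by positivity) fun p => ?_)
        (half_lt_self hε)
      obtain ⟨f, hf, hfp⟩ := hFP p
      refine le_trans ?_ hfp
      have h2 : ‖P p - F.starProjection (P p)‖ = ⨅ x : F, ‖P p - x‖ :=
        Submodule.starProjection_minimal (P p)
      have h3 : (P - F.starProjection ∘L P) p = P p - F.starProjection (P p) := rfl
      rw [h3, h2]
      exact ciInf_le ⟨0, by rintro _ ⟨x, rfl⟩; exact norm_nonneg _⟩ (⟨f, hf⟩ : F)
  exact isClosed_setOfPred_isCompactOperator.closure_subset hmem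

open UnboundedOperator in
/-- The operator of a symmetric closed semibounded form, given by an operator `B` on the form
domain `V`, which is compactly and densely embedded by `P`. -/
theorem exists_operator_of_form [CompleteSpace H] [CompleteSpace V] (P : V →L[ℂ] H)
    (hP : DenseRange P) (hc : IsCompactOperator P)
    (B : V →L[ℂ] V) (hB : ∀ x y, inner ℂ (B x) y = inner ℂ x (B y)) {c : ℝ} (hc0 : 0 < c) (l : ℝ)
    (hcoer : ∀ p, c * ‖p‖ ^ 2 ≤ (inner ℂ p (B p)).re + l * ‖P p‖ ^ 2) :
    ∃ A : H →ₗ.[ℂ] H,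
      (∀ u f, (u, f) ∈ A.graph ↔ ∃ p, P p = u ∧ ∀ q, inner ℂ q (B p) = inner ℂ (P q) f) ∧
      IsSelfAdjoint A ∧ HasPurelyDiscreteSpectrum A := by
  set P' : H →L[ℂ] V := P.adjoint
  have hP' : ∀ (q : V) (f : H), inner ℂ q (P' f) = inner ℂ (P q) f := fun q f =>
    P.adjoint_inner_right q f
  have hP'' : ∀ (q : V) (f : H), inner ℂ (P' f) q = inner ℂ f (P q) := fun q f =>
    P.adjoint_inner_left q f
  -- `D` represents the form shifted by `l` times the `H` inner product, so `hcoer` says that it is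
  -- coercive.
  let D : V →L[ℂ] V := B + (l : ℂ) • (P' ∘L P)
  have hD : ∀ p, D p = B p + (l : ℂ) • P' (P p) := fun p => rfl
  have hDs : ∀ x y, inner ℂ (D x) y = inner ℂ x (D y) := by
    intro x y
    rw [hD, hD, inner_add_left, inner_add_right, inner_smul_left, inner_smul_right, hP', hP'', hB,
      Complex.conj_ofReal]
  have hDc : ∀ p, c * ‖p‖ ^ 2 ≤ (inner ℂ p (D p)).re := by
    intro p
    refine (hcoer p).trans_eq ?_
    rw [hD, inner_add_right, inner_smul_right, hP', inner_self_eq_norm_sq_to_K, Complex.add_re]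
    congr 1
    rw [Complex.re_ofReal_mul]
    norm_cast
  have hbij := bijective_of_coercive D hDs hc0 hDc
  let e : V ≃L[ℂ] V := ContinuousLinearEquiv.ofBijective D
    (LinearMap.ker_eq_bot.mpr hbij.1) (LinearMap.range_eq_top.mpr hbij.2)
  have he : ∀ x, D (e.symm x) = x := fun x => e.apply_symm_apply x
  have he' : ∀ x, e.symm (D x) = x := fun x => e.symm_apply_apply x
  let K : H →L[ℂ] H := P ∘L (e.symm : V →L[ℂ] V) ∘L P'
  have hK : ∀ f, K f = P (e.symm (P' f)) := fun f => rfl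
  have hKc : IsCompactOperator K := hc.comp_clm ((e.symm : V →L[ℂ] V) ∘L P')
  have hKs : (K : H →ₗ[ℂ] H).IsSymmetric := by
    intro f g
    change inner ℂ (K f) g = inner ℂ f (K g)
    rw [hK, hK, ← hP', ← hP'']
    conv_lhs => rw [← he (P' g)]
    conv_rhs => rw [← he (P' f)]
    rw [hDs]
  have hKi : Function.Injective K := by
    rw [injective_iff_map_eq_zero]
    intro f hf
    -- With `g = D⁻¹ P* f` one has `⟪g, D g⟫ = ⟪P g, f⟫ = ⟪K f, f⟫ = 0`. Coercivity gives `P* f =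
    -- 0`, and dense range of `P` gives `f = 0`.
    have h1 : inner ℂ (e.symm (P' f)) (D (e.symm (P' f))) = 0 := by
      rw [he, hP', ← hK, hf, inner_zero_left]
    have h2 := hDc (e.symm (P' f))
    rw [h1] at h2
    have h3 : e.symm (P' f) = 0 := by
      by_contra h4
      have := mul_pos hc0 (pow_pos (norm_pos_iff.mpr h4) 2)
      simp at h2
      linarith
    have h5 : P' f = 0 := by rw [← he (P' f), h3, map_zero]
    apply hP.eq_zero_of_inner_left ℂ
    intro q
    rw [← hP'', h5, inner_zero_left]
  obtain ⟨A, hA, hsa, hds⟩ := exists_selfAdjoint_of_compact_resolvent K hKc hKs hKi l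
  refine ⟨A, fun u f => ?_, hsa, hds⟩
  rw [hA]
  -- The weak equation is thus `p = D⁻¹ P* (f + l u)` with `u = P p`; injectivity of `P` plays no
  -- role.
  have key : ∀ p, (∀ q, inner ℂ q (B p) = inner ℂ (P q) f) ↔ D p = P' (f + (l : ℂ) • P p) := by
    intro p
    rw [hD, map_add, map_smul, add_left_inj]
    constructor
    · intro h
      refine ext_inner_left ℂ fun q => ?_
      rw [h, hP']
    · intro h q
      rw [h, hP']
  constructor
  · intro h
    refine ⟨e.symm (P' (f + (l : ℂ) • u)), h.symm, ?_⟩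
    rw [key, he]
    congr 3
  · rintro ⟨p, rfl, h⟩
    rw [key] at h
    rw [hK, ← h, he']

end Abstract

/-! ### Generations of vertices and edges. -/

noncomputable section

namespace MetricTree

variable (T : MetricTree)

theorem covBy_iff {v w : T.Vertex} : v ⋖ w ↔ w ≠ ⊥ ∧ Order.pred w = v := by
  constructor
  · intro h
    refine ⟨?_, h.pred_eq⟩
    rintro rfl
    exact not_lt_bot h.lt
  · rintro ⟨h, rfl⟩
    exact Order.pred_covBy_of_not_isMin (by simpa using h)

theorem gen_eq_zero {v : T.Vertex} : T.gen v = 0 ↔ v = ⊥ := by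
  constructor
  · intro h
    by_contra hv
    have := T.gen_of_ne_bot v hv
    omega
  · rintro rfl
    exact T.gen_bot

theorem finite_level (n : ℕ) : {v : T.Vertex | T.gen v = n}.Finite := by
  induction n with
  | zero =>
    refine (finite_singleton (⊥ : T.Vertex)).subset fun v hv => ?_
    exact T.gen_eq_zero.mp hv
  | succ n ih =>
    refine (ih.biUnion fun v _ => T.finite_children v).subset fun w hw => ?_
    have hw' : T.gen w = n + 1 := hw
    have hne : w ≠ ⊥ := by
      rintro rfl
      rw [gen_bot] at hw'
      omega
    refine mem_biUnion (x := Order.pred w) ?_ (T.covBy_iff.mpr ⟨hne, rfl⟩)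
    have := T.gen_of_ne_bot w hne
    change T.gen (Order.pred w) = n
    omega

/-- The vertices of generation `n`. -/
def level (n : ℕ) : Finset T.Vertex := (T.finite_level n).toFinset

@[simp]
theorem mem_level {n : ℕ} {v : T.Vertex} : v ∈ T.level n ↔ T.gen v = n := by
  simp [level]

theorem finite_edgeLevel (n : ℕ) : {e : T.Edge | T.gen e.1 = n}.Finite :=
  (T.finite_level n).preimage Subtype.val_injective.injOn

/-- The edges of generation `n`. -/
def edgeLevel (n : ℕ) : Finset T.Edge := (T.finite_edgeLevel n).toFinset

@[simp]
theorem mem_edgeLevel {n : ℕ} {e : T.Edge} : e ∈ T.edgeLevel n ↔ T.gen e.1 = n := by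
  simp [edgeLevel]

theorem gen_edge_pos (e : T.Edge) : 0 < T.gen e.1 :=
  Nat.pos_of_ne_zero fun h => e.2 (T.gen_eq_zero.mp h)

instance countable_edge : Countable T.Edge := by
  have : (⋃ n, {e : T.Edge | T.gen e.1 = n}) = univ := by
    ext e; simp
  rw [← countable_univ_iff, ← this]
  exact countable_iUnion fun n => (T.finite_edgeLevel n).countable

/-- Beyond generation 0 vertices and edges correspond; the shift `n + 1` avoids the root, which
names no edge. -/
theorem sum_edgeLevel {M : Type*} [AddCommMonoid M] (φ : T.Vertex → M) (n : ℕ) :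
    ∑ e ∈ T.edgeLevel (n + 1), φ e.1 = ∑ v ∈ T.level (n + 1), φ v := by
  refine Finset.sum_bij (fun e _ => e.1) ?_ ?_ ?_ ?_
  · intro e he; simpa using he
  · intro a _ b _ h; exact Subtype.ext h
  · intro v hv
    rw [mem_level] at hv
    have hne : v ≠ ⊥ := by
      rintro rfl
      rw [gen_bot] at hv
      omega
    exact ⟨⟨v, hne⟩, by simpa using hv, rfl⟩
  · intros; rfl

theorem card_edgeLevel (n : ℕ) : (T.edgeLevel (n + 1)).card = (T.level (n + 1)).card := by
  simpa only [Finset.card_eq_sum_ones] using T.sum_edgeLevel (fun _ => 1) n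

theorem lo_lt_hi (e : T.Edge) : T.lo e < T.hi e := T.height_pred_lt e.1 e.2

theorem height_nonneg (v : T.Vertex) : 0 ≤ T.height v := by
  induction h : T.gen v generalizing v with
  | zero => rw [T.gen_eq_zero.mp h, height_bot]
  | succ n ih =>
    have hne : v ≠ ⊥ := by
      rintro rfl
      rw [gen_bot] at h
      omega
    have h1 := T.gen_of_ne_bot v hne
    exact (ih (Order.pred v) (by omega)).trans (T.height_pred_lt v hne).le

theorem lo_nonneg (e : T.Edge) : 0 ≤ T.lo e := T.height_nonneg _

/-- A parent has generation one less, so an empty generation leaves all later ones empty; finitely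
many finite generations cannot exhaust an infinite tree. -/
theorem exists_gen_eq [Infinite T.Vertex] (n : ℕ) :
    ∃ v : T.Vertex, T.gen v = n := by
  by_contra hn
  push Not at hn
  have hlt : ∀ v : T.Vertex, T.gen v < n := by
    intro v
    induction h : T.gen v generalizing v with
    | zero =>
      rcases Nat.eq_zero_or_pos n with h0 | h0
      · exact absurd (h.trans h0.symm) (hn v)
      · exact h0
    | succ m ih =>
      have hv : v ≠ ⊥ := fun h0 => by rw [h0, gen_bot] at h; omega
      have h1 := T.gen_of_ne_bot v hv
      have h2 := ih (Order.pred v) (by omega)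
      have h3 := hn v
      omega
  have hfin : (univ : Set T.Vertex).Finite := by
    refine ((finite_lt_nat n).biUnion fun m _ => T.finite_level m).subset fun v _ => ?_
    exact mem_biUnion (hlt v) rfl
  exact infinite_univ hfin

theorem level_card_pos [Infinite T.Vertex] (n : ℕ) :
    0 < (T.level n).card := by
  obtain ⟨v, hv⟩ := T.exists_gen_eq n
  exact Finset.card_pos.mpr ⟨v, by simpa using hv⟩

/-! ### Radial trees: averages over generations and the counting function. -/

variable {T}

theorem IsRadial.height_eq (hT : T.IsRadial) {v w : T.Vertex} (h : T.gen v = T.gen w) :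
    T.height v = T.height w := by
  induction hn : T.gen v generalizing v w with
  | zero => rw [T.gen_eq_zero.mp hn, T.gen_eq_zero.mp (h.symm.trans hn)]
  | succ n ih =>
    have hv : v ≠ ⊥ := fun h0 => by rw [h0, gen_bot] at hn; omega
    have hw : w ≠ ⊥ := fun h0 => by rw [h, h0, gen_bot] at hn; omega
    have h1 := T.gen_of_ne_bot v hv
    have h2 := T.gen_of_ne_bot w hw
    rw [T.height_of_ne_bot v hv, T.height_of_ne_bot w hw,
      ih (v := Order.pred v) (w := Order.pred w) (by omega) (by omega),
      hT.1 ⟨v, hv⟩ ⟨w, hw⟩ h]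

/-- In a radial tree each vertex of generation `n` has equally many children. -/
theorem IsRadial.sum_pred [Infinite T.Vertex] (hT : T.IsRadial) (n : ℕ) :
    ∃ b : ℕ, ∀ φ : T.Vertex → ENNReal,
      ∑ e ∈ T.edgeLevel (n + 1), φ (Order.pred e.1) = b * ∑ v ∈ T.level n, φ v := by
  classical
  obtain ⟨v₀, hv₀⟩ := T.exists_gen_eq n
  refine ⟨T.degree v₀, fun φ => ?_⟩
  rw [← Finset.sum_fiberwise_of_maps_to' (t := T.level n) (g := fun e : T.Edge => Order.pred e.1),
    Finset.mul_sum]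
  · refine Finset.sum_congr rfl fun v hv => ?_
    rw [Finset.sum_const, nsmul_eq_mul]
    congr 2
    rw [mem_level] at hv
    rw [hT.2 v₀ v (hv₀.trans hv.symm), degree, ← Set.ncard_coe_finset]
    rw [← Set.ncard_image_of_injective _ (Subtype.val_injective (p := fun v : T.Vertex => v ≠ ⊥))]
    congr 1
    ext w
    simp only [mem_image, Finset.mem_coe, Finset.mem_filter, mem_edgeLevel, mem_ofPred_eq,
      covBy_iff]
    constructor
    · rintro ⟨e, ⟨-, h2⟩, rfl⟩
      exact ⟨e.2, h2⟩
    · rintro ⟨h1, h2⟩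
      refine ⟨⟨w, h1⟩, ⟨?_, h2⟩, rfl⟩
      rw [T.gen_of_ne_bot w h1, h2, hv]
  · intro e he
    rw [mem_edgeLevel] at he
    have := T.gen_of_ne_bot e.1 e.2
    rw [mem_level]
    omega

/-- The common branching number `b` multiplies both the sum and, by the case `φ = 1`, the number of
vertices, so it cancels; it is nonzero since every generation is inhabited. This is what makes
averages telescope. -/
theorem IsRadial.average_pred [Infinite T.Vertex] (hT : T.IsRadial) (n : ℕ)
    (φ : T.Vertex → ENNReal) :
    ((T.level (n + 1)).card : ENNReal)⁻¹ * ∑ e ∈ T.edgeLevel (n + 1), φ (Order.pred e.1) =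
      ((T.level n).card : ENNReal)⁻¹ * ∑ v ∈ T.level n, φ v := by
  obtain ⟨b, hb⟩ := hT.sum_pred n
  have h1 := hb fun _ => 1
  simp only [Finset.sum_const, nsmul_eq_mul, mul_one, T.card_edgeLevel] at h1
  have hN := T.level_card_pos n
  have hN' := T.level_card_pos (n + 1)
  have hb0 : (b : ENNReal) ≠ 0 := by
    intro h0
    rw [h0, zero_mul] at h1
    have : (T.level (n + 1)).card = 0 := by exact_mod_cast h1
    omega
  rw [hb, h1, ENNReal.mul_inv (Or.inl hb0) (Or.inl (by simp))]
  calc _ = ((b : ENNReal)⁻¹ * b) * (((T.level n).card : ENNReal)⁻¹ * ∑ v ∈ T.level n, φ v) := by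
        ring
    _ = _ := by rw [ENNReal.inv_mul_cancel hb0 (by simp), one_mul]

theorem height_le_radius (hR : T.radius < ⊤) (v : T.Vertex) : T.height v ≤ T.radius.toReal := by
  have h : ENNReal.ofReal (T.vertexPoint v).abs ≤ T.radius :=
    le_iSup (fun x : T.Point => ENNReal.ofReal x.abs) (T.vertexPoint v)
  exact (ENNReal.ofReal_le_iff_le_toReal hR.ne).mp h

theorem IsRadial.lo_eq (hT : T.IsRadial) {e f : T.Edge} (h : T.gen e.1 = T.gen f.1) :
    T.lo e = T.lo f := by
  apply hT.height_eq
  have h1 := T.gen_of_ne_bot e.1 e.2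
  have h2 := T.gen_of_ne_bot f.1 f.2
  omega

theorem IsRadial.hi_eq (hT : T.IsRadial) {e f : T.Edge} (h : T.gen e.1 = T.gen f.1) :
    T.hi e = T.hi f := hT.height_eq h

theorem IsRadial.height_lt (hT : T.IsRadial) {v w : T.Vertex}
    (h : T.gen v < T.gen w) : T.height v < T.height w := by
  induction hn : T.gen w generalizing w with
  | zero => omega
  | succ n ih =>
    have hw : w ≠ ⊥ := fun h0 => by rw [h0, gen_bot] at hn; omega
    have h1 := T.gen_of_ne_bot w hw
    have h2 := T.height_pred_lt w hw
    rcases Nat.lt_or_ge (T.gen v) (T.gen (Order.pred w)) with h3 | h3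
    · exact (ih h3 (by omega)).trans h2
    · rw [hT.height_eq (show T.gen v = T.gen (Order.pred w) by omega)]
      exact h2

theorem IsRadial.height_le (hT : T.IsRadial) {v w : T.Vertex}
    (h : T.gen v ≤ T.gen w) : T.height v ≤ T.height w := by
  rcases h.lt_or_eq with h | h
  · exact (hT.height_lt h).le
  · exact (hT.height_eq h).le

theorem counting_eq (t : ℝ) : T.counting t = {e : T.Edge | t ∈ Icc (T.lo e) (T.hi e)}.ncard := by
  unfold counting
  congr 1
  ext e
  constructor
  · rintro ⟨_, ⟨s, hs, rfl⟩, rfl⟩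
    rw [mem_ofPred_eq, T.edgePoint_abs e s hs]
    exact hs
  · intro ht
    exact ⟨_, ⟨t, ht, rfl⟩, T.edgePoint_abs e t ht⟩

/-- The open interval matters: at the height of a vertex other than the root, closed edges of two
generations are counted. -/
theorem IsRadial.counting_eq_card [Infinite T.Vertex] (hT : T.IsRadial) (e : T.Edge) {t : ℝ}
    (ht : t ∈ Ioo (T.lo e) (T.hi e)) : T.counting t = (T.level (T.gen e.1)).card := by
  obtain ⟨n, hn⟩ := Nat.exists_eq_add_of_lt (T.gen_edge_pos e)
  have hn' : T.gen e.1 = n + 1 := by omega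
  rw [counting_eq, hn', ← card_edgeLevel, ← Set.ncard_coe_finset]
  congr 1
  ext f
  rw [Finset.mem_coe, mem_edgeLevel, mem_ofPred_eq]
  have h1 := T.gen_of_ne_bot e.1 e.2
  have h2 := T.gen_of_ne_bot f.1 f.2
  constructor
  · rintro ⟨h3, h4⟩
    by_contra h5
    rcases Nat.lt_or_gt_of_ne h5 with h5 | h5
    · have := hT.height_le (v := f.1) (w := Order.pred e.1) (by omega)
      exact absurd (h4.trans this) (not_le.mpr ht.1)
    · have := hT.height_le (v := e.1) (w := Order.pred f.1) (by omega)
      exact absurd (this.trans h3) (not_le.mpr ht.2)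
  · intro h3
    rw [hT.lo_eq (h3.trans hn'.symm), hT.hi_eq (h3.trans hn'.symm)]
    exact ⟨ht.1.le, ht.2.le⟩

theorem IsRadial.counting_zero_pos [Infinite T.Vertex] (hT : T.IsRadial) : 0 < T.counting 0 := by
  have hset : {e : T.Edge | (0 : ℝ) ∈ Icc (T.lo e) (T.hi e)} = {e : T.Edge | T.gen e.1 = 1} := by
    ext e
    have h1 := T.gen_of_ne_bot e.1 e.2
    constructor
    · rintro ⟨h2, -⟩
      by_contra h3
      change ¬ T.gen e.1 = 1 at h3
      have h4 := hT.height_lt (v := ⊥) (w := Order.pred e.1) (by rw [gen_bot]; omega)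
      rw [height_bot] at h4
      exact absurd h2 (not_le.mpr h4)
    · intro h2
      change T.gen e.1 = 1 at h2
      have h3 : Order.pred e.1 = ⊥ := T.gen_eq_zero.mp (by omega)
      refine ⟨?_, T.height_nonneg _⟩
      rw [lo, h3, height_bot]
  rw [counting_eq, hset, Set.ncard_pos (T.finite_edgeLevel 1)]
  obtain ⟨v, hv⟩ := T.exists_gen_eq 1
  exact ⟨⟨v, fun h => by rw [h, gen_bot] at hv; omega⟩, hv⟩

end MetricTree

end

/-! ### One-dimensional inequalities and step functions. -/

noncomputable section

/-- The Cauchy-Schwarz inequality against the constant function. -/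
theorem lintegral_sq_le {α : Type*} [MeasurableSpace α] (μ : Measure α) {f : α → ENNReal}
    (hf : AEMeasurable f μ) : (∫⁻ x, f x ∂μ) ^ 2 ≤ μ univ * ∫⁻ x, f x ^ 2 ∂μ := by
  have h := ENNReal.lintegral_mul_le_Lp_mul_Lq μ Real.HolderConjugate.two_two hf
    (aemeasurable_const (b := (1 : ENNReal)))
  simp only [Pi.mul_apply, mul_one, ENNReal.one_rpow, lintegral_const, one_mul] at h
  calc (∫⁻ x, f x ∂μ) ^ 2 ≤ ((∫⁻ x, f x ^ (2 : ℝ) ∂μ) ^ (1 / 2 : ℝ) * μ univ ^ (1 / 2 : ℝ)) ^ 2 := by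
        gcongr
    _ = _ := by
        rw [mul_pow, ← ENNReal.rpow_natCast, ← ENNReal.rpow_natCast, ← ENNReal.rpow_mul,
          ← ENNReal.rpow_mul]
        norm_num
        rw [mul_comm]

/-- The oscillation of a `C¹` function is controlled by its energy. -/
theorem enorm_sub_sq_le {U : ℝ → ℂ} {a b s r : ℝ} (hU : ContDiffOn ℝ 1 U (Icc a b))
    (has : a ≤ s) (hsr : s ≤ r) (hrb : r ≤ b) :
    ‖U r - U s‖ₑ ^ 2 ≤ ENNReal.ofReal (r - s) * ∫⁻ t in Ioo s r, ‖deriv U t‖ₑ ^ 2 := by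
  have h1 := intervalIntegral.integral_deriv_of_contDiffOn_Icc
    (hU.mono (Icc_subset_Icc has hrb)) hsr
  have h2 : ‖U r - U s‖ₑ ≤ ∫⁻ t in Ioo s r, ‖deriv U t‖ₑ := by
    rw [← h1, intervalIntegral.integral_of_le hsr, ← restrict_Ioo_eq_restrict_Ioc]
    exact enorm_integral_le_lintegral_enorm _
  have h3 := lintegral_sq_le (volume.restrict (Ioo s r)) (f := fun t => ‖deriv U t‖ₑ)
    (measurable_deriv U).enorm.aemeasurable
  rw [Measure.restrict_apply_univ, Real.volume_Ioo] at h3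
  exact (by gcongr : ‖U r - U s‖ₑ ^ 2 ≤ _).trans h3

/-- A one-dimensional Hardy type inequality. -/
theorem enorm_sq_div_le {U : ℝ → ℂ} {a b s r R : ℝ} (hU : ContDiffOn ℝ 1 U (Icc a b))
    (has : a ≤ s) (hsr : s < r) (hrb : r ≤ b) (hR : r < R) :
    ‖U s‖ₑ ^ 2 / ENNReal.ofReal (R - s) ≤
      ‖U r‖ₑ ^ 2 / ENNReal.ofReal (R - r) + ∫⁻ t in Ioo s r, ‖deriv U t‖ₑ ^ 2 := by
  have h := enorm_sub_sq_le hU has hsr.le hrb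
  set I := ∫⁻ t in Ioo s r, ‖deriv U t‖ₑ ^ 2
  rcases eq_or_ne I ⊤ with hI | hI
  · rw [hI]; simp
  have hq : 0 < r - s := sub_pos.mpr hsr
  have hp : 0 < R - r := sub_pos.mpr hR
  have hpq : 0 < R - s := by linarith
  rw [← ENNReal.ofReal_toReal hI, ← ofReal_norm, ← ENNReal.ofReal_pow (norm_nonneg _),
    ← ENNReal.ofReal_mul hq.le, ENNReal.ofReal_le_ofReal_iff (by positivity)] at h
  rw [← ENNReal.ofReal_toReal hI, ← ofReal_norm, ← ofReal_norm,
    ← ENNReal.ofReal_pow (norm_nonneg _), ← ENNReal.ofReal_pow (norm_nonneg _),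
    ← ENNReal.ofReal_div_of_pos hpq, ← ENNReal.ofReal_div_of_pos hp,
    ← ENNReal.ofReal_add (by positivity) (by positivity)]
  apply ENNReal.ofReal_le_ofReal
  have h1 : ‖U s‖ ≤ ‖U r‖ + ‖U r - U s‖ := by
    have := norm_sub_le (U r) (U r - U s)
    rwa [sub_sub_cancel] at this
  set x := ‖U s‖
  set y := ‖U r‖
  set k := ‖U r - U s‖
  have hx : 0 ≤ x := norm_nonneg _
  have h2 : k ^ 2 / (r - s) ≤ I.toReal := by
    rw [div_le_iff₀ hq]; linarith
  refine le_trans ?_ (add_le_add_right h2 _)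
  rw [div_add_div _ _ hp.ne' hq.ne', div_le_div_iff₀ hpq (by positivity)]
  have h3 : x ^ 2 ≤ (y + k) ^ 2 := pow_le_pow_left₀ hx h1 2
  -- This is `(y + k)²/(p + q) ≤ y²/p + k²/q` with `p = R - r`, `q = r - s`; after clearing
  -- denominators the difference is `(q y - p k)²`.
  have h4 : (y + k) ^ 2 * ((R - r) * (r - s)) ≤
      (y ^ 2 * (r - s) + (R - r) * k ^ 2) * (R - s) := by
    nlinarith [sq_nonneg ((r - s) * y - (R - r) * k)]
  have h5 : 0 ≤ (R - r) * (r - s) := by positivity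
  exact (mul_le_mul_of_nonneg_right h3 h5).trans h4

theorem enorm_sq_eq_lintegral {α : Type*} [MeasurableSpace α] {μ : Measure α} (p : Lp ℂ 2 μ)
    {f : α → ℂ} (hf : p =ᵐ[μ] f) : ‖p‖ₑ ^ 2 = ∫⁻ x, ‖f x‖ₑ ^ 2 ∂μ := by
  rw [Lp.enorm_def, eLpNorm_congr_ae hf]
  have := eLpNorm_nnreal_pow_eq_lintegral (f := f) (μ := μ) (p := 2) (by norm_num)
  norm_num at this
  exact this

/-- The step functions over finitely many sets of finite measure are finite-dimensional. -/
theorem exists_finiteDimensional_step {α ι : Type*} [MeasurableSpace α] (μ : Measure α)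
    (J : Finset ι) (S : ι → Set α) (hS : ∀ i, MeasurableSet (S i)) (hμ : ∀ i, μ (S i) ≠ ⊤) :
    ∃ F : Submodule ℂ (Lp ℂ 2 μ), FiniteDimensional ℂ F ∧ ∀ c : ι → ℂ, ∃ f ∈ F,
      f =ᵐ[μ] fun x => ∑ i ∈ J, (S i).indicator (fun _ => c i) x := by
  classical
  let g : ι → Lp ℂ 2 μ := fun i => indicatorConstLp 2 (hS i) (hμ i) (1 : ℂ)
  refine ⟨Submodule.span ℂ (J.image g : Finset (Lp ℂ 2 μ)), FiniteDimensional.span_finset ℂ _,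
    fun c => ⟨∑ i ∈ J, c i • g i, ?_, ?_⟩⟩
  · refine Submodule.sum_mem _ fun i hi => Submodule.smul_mem _ _ (Submodule.subset_span ?_)
    exact Finset.mem_coe.mpr (Finset.mem_image_of_mem g hi)
  · have hg : ∀ i, g i =ᵐ[μ] (S i).indicator fun _ => (1 : ℂ) := fun i => indicatorConstLp_coeFn
    clear_value g
    induction J using Finset.induction_on with
    | empty => simpa only [Finset.sum_empty] using! Lp.coeFn_zero ℂ 2 μ
    | insert i J hi ih =>
      rw [Finset.sum_insert hi]
      filter_upwards [Lp.coeFn_add (c i • g i) (∑ i ∈ J, c i • g i), ih, hg i,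
        Lp.coeFn_smul (c i) (g i)] with x h1 h2 h3 h4
      rw [h1, Pi.add_apply, h2, h4, Pi.smul_apply, h3, Finset.sum_insert hi]
      congr 1
      by_cases hx : x ∈ S i <;> simp [hx]

/-! ### Measurability and integration on the tree. -/

namespace MetricTree

variable {T : MetricTree}

theorem edgePoint_of_mem_Ioc (e : T.Edge) {t : ℝ} (ht : t ∈ Ioc (T.lo e) (T.hi e)) :
    (T.edgePoint e t).top = e.1 ∧ (T.edgePoint e t).abs = t := by
  unfold edgePoint
  rw [dif_neg (not_le.mpr ht.1)]
  exact ⟨rfl, min_eq_left ht.2⟩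

theorem edgePoint_of_le_lo (e : T.Edge) {t : ℝ} (ht : t ≤ T.lo e) :
    T.edgePoint e t = T.vertexPoint (Order.pred e.1) := by
  unfold edgePoint
  rw [dif_pos ht]

theorem edgePoint_of_hi_le (e : T.Edge) {t : ℝ} (ht : T.hi e ≤ t) :
    T.edgePoint e t = T.vertexPoint e.1 := by
  unfold edgePoint
  rw [dif_neg (not_le.mpr ((T.lo_lt_hi e).trans_le ht))]
  ext
  · rfl
  · exact min_eq_right ht

theorem measurable_of_edges {β : Type*} [MeasurableSpace β] {f : T.Point → β}
    (h : ∀ e, Measurable fun t => f (T.edgePoint e t)) : Measurable f := by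
  intro s hs
  rw [instMeasurableSpacePoint, MeasurableSpace.measurableSet_iInf]
  intro e
  exact h e hs

theorem edgePoint_max_min (e : T.Edge) (t : ℝ) :
    T.edgePoint e t = T.edgePoint e (max (T.lo e) (min t (T.hi e))) := by
  have h0 := (T.lo_lt_hi e).le
  rcases le_total t (T.lo e) with h | h
  · rw [edgePoint_of_le_lo e h, edgePoint_of_le_lo]
    rw [min_eq_left (h.trans h0), max_eq_left h]
  · rcases le_total t (T.hi e) with h' | h'
    · rw [min_eq_left h', max_eq_right h]
    · rw [edgePoint_of_hi_le e h', edgePoint_of_hi_le]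
      rw [min_eq_right h', max_eq_right h0]

theorem measurable_abs : Measurable (Point.abs (T := T)) := by
  refine measurable_of_edges fun e => ?_
  have : (fun t => (T.edgePoint e t).abs) = fun t => max (T.lo e) (min t (T.hi e)) := by
    funext t
    rw [edgePoint_max_min, edgePoint_abs]
    exact ⟨le_max_left _ _, max_le (T.lo_lt_hi e).le (min_le_right _ _)⟩
  rw [this]
  fun_prop

theorem measurableSet_top_eq (v : T.Vertex) : MeasurableSet {x : T.Point | x.top = v} := by
  rw [instMeasurableSpacePoint, MeasurableSpace.measurableSet_iInf]
  intro e
  have : T.edgePoint e ⁻¹' {x : T.Point | x.top = v} =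
      (Iic (T.lo e) ∩ {_t | Order.pred e.1 = v}) ∪ (Ioi (T.lo e) ∩ {_t | e.1 = v}) := by
    ext t
    simp only [mem_preimage, mem_ofPred_eq, mem_union, mem_inter_iff, mem_Iic, mem_Ioi]
    unfold edgePoint
    split_ifs with h
    · simp [h, vertexPoint]
    · simp [h, not_le.mp h]
  change MeasurableSet (T.edgePoint e ⁻¹' {x : T.Point | x.top = v})
  rw [this]
  exact (measurableSet_Iic.inter (MeasurableSet.const _)).union
    (measurableSet_Ioi.inter (MeasurableSet.const _))

/-- Endpoints have zero length, so open edges suffice; this avoids the exceptional values at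
vertices. -/
theorem lintegral_weighted {ρ : T.Point → ℝ} (hρ : Measurable ρ) {φ : T.Point → ENNReal}
    (hφ : Measurable φ) : ∫⁻ x, φ x ∂(weighted ρ) =
      ∑' e : T.Edge, ∫⁻ t in Ioo (T.lo e) (T.hi e),
        φ (T.edgePoint e t) * ENNReal.ofReal (ρ (T.edgePoint e t)) := by
  rw [weighted, lintegral_withDensity_eq_lintegral_mul _ hρ.ennreal_ofReal hφ, lengthMeasure,
    lintegral_sum_measure]
  refine tsum_congr fun e => ?_
  rw [lintegral_map (hρ.ennreal_ofReal.mul hφ) (T.measurable_edgePoint e),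
    ← restrict_Ioo_eq_restrict_Icc]
  refine lintegral_congr fun t => ?_
  rw [Pi.mul_apply, mul_comm]

theorem edgeDeriv_edgePoint (u : T.Point → ℂ) (e : T.Edge) {t : ℝ}
    (ht : t ∈ Ioc (T.lo e) (T.hi e)) :
    edgeDeriv u (T.edgePoint e t) = deriv (fun t => u (T.edgePoint e t)) t := by
  obtain ⟨h1, h2⟩ := edgePoint_of_mem_Ioc e ht
  unfold edgeDeriv
  rw [dif_pos (by rw [h1]; exact e.2), h2]
  congr 1
  funext s
  congr 2
  exact Subtype.ext h1

theorem IsTest.continuousOn {bc : RootCondition} {u : T.Point → ℂ} (hu : IsTest bc u)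
    (e : T.Edge) : ContinuousOn (fun t => u (T.edgePoint e t)) (Icc (T.lo e) (T.hi e)) :=
  (hu.contDiffOn e).continuousOn

/-- The parametrization is constant outside its edge, so clamping the parameter makes continuity on
the closed edge global. -/
theorem IsTest.measurable {bc : RootCondition} {u : T.Point → ℂ} (hu : IsTest bc u) :
    Measurable u := by
  refine measurable_of_edges fun e => ?_
  have h : (fun t => u (T.edgePoint e t)) =
      (fun t => u (T.edgePoint e t)) ∘ fun t => max (T.lo e) (min t (T.hi e)) := by
    funext t
    rw [Function.comp_apply, ← edgePoint_max_min]
  rw [h]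
  refine Continuous.measurable (ContinuousOn.comp_continuous (hu.continuousOn e) (by fun_prop) ?_)
  intro t
  exact ⟨le_max_left _ _, max_le (T.lo_lt_hi e).le (min_le_right _ _)⟩

theorem measurable_edgeDeriv (u : T.Point → ℂ) : Measurable (edgeDeriv u) := by
  refine measurable_of_edges fun e => ?_
  have h : (fun t => edgeDeriv u (T.edgePoint e t)) = fun t => if t ≤ T.lo e then
      edgeDeriv u (T.vertexPoint (Order.pred e.1)) else
      deriv (fun t => u (T.edgePoint e t)) (min t (T.hi e)) := by
    funext t
    split_ifs with h
    · rw [edgePoint_of_le_lo e h]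
    · push Not at h
      rw [edgePoint_max_min, max_eq_right (le_min h.le (T.lo_lt_hi e).le),
        edgeDeriv_edgePoint u e ⟨lt_min h (T.lo_lt_hi e), min_le_right _ _⟩]
  rw [h]
  refine Measurable.ite measurableSet_Iic measurable_const ?_
  exact (measurable_deriv _).comp (by fun_prop)

/-! ### Growing weights and the weighted Hardy inequality. -/

/-- A bounded symmetric weight for which `counting * w` is increasing up to a constant. -/
structure IsGrowing (w : T.Point → ℝ) (c K : ℝ) : Prop where
  weight : IsWeight w
  symm : IsSymmetric w
  le : ∀ x, w x ≤ c
  pos : 0 < K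
  growth : ∀ x y : T.Point, x.abs ≤ y.abs →
    T.counting x.abs * w x ≤ K * (T.counting y.abs * w y)

/-- The energy of `u` on the edge `e`. -/
def edgeEnergy (w : T.Point → ℝ) (u : T.Point → ℂ) (e : T.Edge) : ENNReal :=
  ∫⁻ t in Ioo (T.lo e) (T.hi e),
    ‖deriv (fun t => u (T.edgePoint e t)) t‖ₑ ^ 2 * ENNReal.ofReal (w (T.edgePoint e t))

theorem Ioo_subset_Ioc_edge (e : T.Edge) : Ioo (T.lo e) (T.hi e) ⊆ Ioc (T.lo e) (T.hi e) :=
  Ioo_subset_Ioc_self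

theorem lintegral_edgeDeriv {w : T.Point → ℝ} (hw : Measurable w) (u : T.Point → ℂ) :
    ∫⁻ x, ‖edgeDeriv u x‖ₑ ^ 2 ∂(weighted w) = ∑' e, edgeEnergy w u e := by
  rw [lintegral_weighted hw ((measurable_edgeDeriv u).enorm.pow_const 2)]
  refine tsum_congr fun e => setLIntegral_congr_fun measurableSet_Ioo fun t ht => ?_
  simp only [edgeDeriv_edgePoint u e (Ioo_subset_Ioc_edge e ht)]

theorem IsGrowing.card_mul_le [Infinite T.Vertex]
    {w : T.Point → ℝ} {c K : ℝ} (hw : IsGrowing w c K)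
    (hT : T.IsRadial) {e f : T.Edge} {s t : ℝ} (hs : s ∈ Ioo (T.lo e) (T.hi e))
    (ht : t ∈ Ioo (T.lo f) (T.hi f)) (hst : s ≤ t) :
    (T.level (T.gen e.1)).card * w (T.edgePoint e s) ≤
      K * ((T.level (T.gen f.1)).card * w (T.edgePoint f t)) := by
  have h1 := (edgePoint_of_mem_Ioc e (Ioo_subset_Ioc_edge e hs)).2
  have h2 := (edgePoint_of_mem_Ioc f (Ioo_subset_Ioc_edge f ht)).2
  have h3 := hw.growth (T.edgePoint e s) (T.edgePoint f t) (by rwa [h1, h2])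
  rwa [h1, h2, hT.counting_eq_card e hs, hT.counting_eq_card f ht] at h3

/-- The growth condition is compared with the root. The bound depends on the edge through the size
of its generation; no bound uniform over the tree is claimed. -/
theorem IsGrowing.exists_lower_bound [Infinite T.Vertex]
    {w : T.Point → ℝ} {c K : ℝ} (hw : IsGrowing w c K)
    (hT : T.IsRadial) (e : T.Edge) :
    ∃ κ : ℝ, 0 < κ ∧ ∀ t ∈ Ioo (T.lo e) (T.hi e), κ ≤ w (T.edgePoint e t) := by
  have hN : (0 : ℝ) < (T.level (T.gen e.1)).card := by exact_mod_cast T.level_card_pos _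
  have h0 : (0 : ℝ) < T.counting 0 := by exact_mod_cast hT.counting_zero_pos
  have hK := hw.pos
  have hr := hw.weight.2 (T.vertexPoint ⊥)
  refine ⟨T.counting 0 * w (T.vertexPoint ⊥) / (K * (T.level (T.gen e.1)).card),
    by positivity, fun t ht => ?_⟩
  have h1 := (edgePoint_of_mem_Ioc e (Ioo_subset_Ioc_edge e ht)).2
  have h2 : (T.vertexPoint ⊥).abs = 0 := T.height_bot
  have h3 := hw.growth (T.vertexPoint ⊥) (T.edgePoint e t)
    (by rw [h1, h2]; exact (T.lo_nonneg e).trans ht.1.le)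
  rw [h1, h2, hT.counting_eq_card e ht] at h3
  rw [div_le_iff₀ (by positivity)]
  linarith

theorem IsTest.exists_vertex_bound {bc : RootCondition} {u : T.Point → ℂ} (hu : IsTest bc u) :
    ∃ M, ∀ v : T.Vertex, M ≤ T.gen v → u (T.vertexPoint v) = 0 := by
  obtain ⟨F, hF, hu0⟩ := hu.compact_support
  obtain ⟨M, hM⟩ := (hF.image fun e : T.Edge => T.gen e.1).bddAbove
  refine ⟨M + 1, fun v hv => hu0 _ fun e he => ?_⟩
  rintro ⟨t, ht, htv⟩
  have h1 : T.gen e.1 ≤ M := hM ⟨e, he, rfl⟩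
  have h2 := T.gen_of_ne_bot e.1 e.2
  have h3 : (T.edgePoint e t).top = v := by rw [htv]; rfl
  rcases ht.1.eq_or_lt with h4 | h4
  · rw [edgePoint_of_le_lo e h4.symm.le] at h3
    have : Order.pred e.1 = v := h3
    rw [← this] at hv
    omega
  · rw [(edgePoint_of_mem_Ioc e ⟨h4, ht.2⟩).1] at h3
    rw [← h3] at hv
    omega

theorem IsTest.edge_hardy {bc : RootCondition} {u : T.Point → ℂ} (hu : IsTest bc u) {R : ℝ}
    (hR : ∀ v, T.height v < R) (e : T.Edge) {s : ℝ} (hs : s ∈ Ico (T.lo e) (T.hi e)) :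
    ‖u (T.edgePoint e s)‖ₑ ^ 2 / ENNReal.ofReal (R - s) ≤
      ‖u (T.vertexPoint e.1)‖ₑ ^ 2 / ENNReal.ofReal (R - T.height e.1) +
        ∫⁻ t in Ioo s (T.hi e), ‖deriv (fun t => u (T.edgePoint e t)) t‖ₑ ^ 2 := by
  have := enorm_sq_div_le (hu.contDiffOn e) hs.1 hs.2 le_rfl (hR e.1)
  rwa [edgePoint_of_hi_le e le_rfl] at this

/-- The average over a generation is controlled by the averaged energies beyond it. -/
theorem IsTest.average_le [Infinite T.Vertex]
    {bc : RootCondition} {u : T.Point → ℂ} (hu : IsTest bc u)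
    (hT : T.IsRadial) {R : ℝ} (hR : ∀ v, T.height v < R) :
    ∃ M, ∀ n, ((T.level n).card : ENNReal)⁻¹ *
        ∑ v ∈ T.level n, ‖u (T.vertexPoint v)‖ₑ ^ 2 / ENNReal.ofReal (R - T.height v) ≤
      ∑ m ∈ Finset.Ico (n + 1) (n + 1 + M), ((T.level m).card : ENNReal)⁻¹ *
        ∑ e ∈ T.edgeLevel m, ∫⁻ t in Ioo (T.lo e) (T.hi e),
          ‖deriv (fun t => u (T.edgePoint e t)) t‖ₑ ^ 2 := by
  obtain ⟨M, hM⟩ := hu.exists_vertex_bound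
  refine ⟨M, fun n => ?_⟩
  set X : T.Vertex → ENNReal :=
    fun v => ‖u (T.vertexPoint v)‖ₑ ^ 2 / ENNReal.ofReal (R - T.height v)
  set D : T.Edge → ENNReal := fun e => ∫⁻ t in Ioo (T.lo e) (T.hi e),
          ‖deriv (fun t => u (T.edgePoint e t)) t‖ₑ ^ 2
  -- `IsTest.edge_hardy` from end to end of each edge: the factors `1 / (R - height)` at the two
  -- ends are those of `X` at consecutive generations, so the step can be iterated.
  have hstep : ∀ n, ((T.level n).card : ENNReal)⁻¹ * ∑ v ∈ T.level n, X v ≤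
      ((T.level (n + 1)).card : ENNReal)⁻¹ * ∑ e ∈ T.edgeLevel (n + 1), D e +
      ((T.level (n + 1)).card : ENNReal)⁻¹ * ∑ v ∈ T.level (n + 1), X v := by
    intro n
    rw [← hT.average_pred, ← T.sum_edgeLevel, ← mul_add, ← Finset.sum_add_distrib]
    gcongr with e he
    have := hu.edge_hardy hR e ⟨le_rfl, T.lo_lt_hi e⟩
    rw [edgePoint_of_le_lo e le_rfl] at this
    rw [add_comm]
    exact this
  have hind : ∀ k, ((T.level n).card : ENNReal)⁻¹ * ∑ v ∈ T.level n, X v ≤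
      (∑ m ∈ Finset.Ico (n + 1) (n + 1 + k), ((T.level m).card : ENNReal)⁻¹ *
        ∑ e ∈ T.edgeLevel m, D e) +
      ((T.level (n + k)).card : ENNReal)⁻¹ * ∑ v ∈ T.level (n + k), X v := by
    intro k
    induction k with
    | zero => simp
    | succ k ih =>
      have h1 := hstep (n + k)
      rw [show n + k + 1 = n + 1 + k by ring] at h1
      rw [show n + (k + 1) = n + 1 + k by ring, show n + 1 + (k + 1) = n + 1 + k + 1 from rfl,
        Finset.sum_Ico_succ_top (by omega)]
      exact ih.trans ((add_le_add le_rfl h1).trans_eq (add_assoc _ _ _).symm)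
  refine (hind M).trans_eq ?_
  -- The telescoping stops beyond the support of `u`, without a boundary term.
  have h0 : ∑ v ∈ T.level (n + M), X v = 0 := by
    refine Finset.sum_eq_zero fun v hv => ?_
    rw [mem_level] at hv
    simp [X, hM v (by omega)]
  rw [h0, mul_zero, add_zero]

theorem sum_edgeLevel_le_tsum (φ : T.Edge → ENNReal) (S : Finset ℕ) :
    ∑ m ∈ S, ∑ e ∈ T.edgeLevel m, φ e ≤ ∑' e, φ e := by
  classical
  rw [← Finset.sum_biUnion]
  · exact ENNReal.sum_le_tsum _
  · intro a _ b _ hab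
    rw [Function.onFun, Finset.disjoint_left]
    intro e he he'
    rw [mem_edgeLevel] at he he'
    exact hab (he.symm.trans he')

/-- The Hardy inequality on a sphere. -/
theorem IsTest.sphere_le [Infinite T.Vertex]
    {bc : RootCondition} {u : T.Point → ℂ} (hu : IsTest bc u)
    (hT : T.IsRadial) {R : ℝ} (hR : ∀ v, T.height v < R) {w : T.Point → ℝ} {c K : ℝ}
    (hw : IsGrowing w c K) (e₀ : T.Edge) {s : ℝ} (hs : s ∈ Ioo (T.lo e₀) (T.hi e₀)) :
    ∑ e ∈ T.edgeLevel (T.gen e₀.1), ‖u (T.edgePoint e s)‖ₑ ^ 2 *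
        ENNReal.ofReal (w (T.edgePoint e s)) ≤
      ENNReal.ofReal (R * K) * ∑' e, edgeEnergy w u e := by
  obtain ⟨M, hM⟩ := hu.average_le hT hR
  obtain ⟨k, hk⟩ := Nat.exists_eq_add_of_lt (T.gen_edge_pos e₀)
  rw [zero_add] at hk
  have hIoo : ∀ e ∈ T.edgeLevel (T.gen e₀.1), s ∈ Ioo (T.lo e) (T.hi e) := by
    intro e he
    rw [mem_edgeLevel] at he
    rwa [hT.lo_eq he, hT.hi_eq he]
  set n := T.gen e₀.1 with hn
  have hR0 : 0 < R := (T.height_nonneg ⊥).trans_lt (hR ⊥)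
  have hsR : 0 < R - s := sub_pos.mpr (hs.2.trans (hR _))
  set w₀ := w (T.edgePoint e₀ s) with hw₀
  have hNn : (0 : ℝ) < (T.level n).card := by exact_mod_cast T.level_card_pos _
  -- weights against energies
  have hE : ∀ (e : T.Edge), ∀ A ⊆ Ioo (T.lo e) (T.hi e), MeasurableSet A → (∀ t ∈ A, s ≤ t) →
      ENNReal.ofReal w₀ * ((T.level n).card * ((T.level (T.gen e.1)).card : ENNReal)⁻¹) *
        ∫⁻ t in A, ‖deriv (fun t => u (T.edgePoint e t)) t‖ₑ ^ 2 ≤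
      ENNReal.ofReal K * edgeEnergy w u e := by
    intro e A hA hAm hAs
    have hNe : (0 : ℝ) < (T.level (T.gen e.1)).card := by exact_mod_cast T.level_card_pos _
    rw [edgeEnergy, ← lintegral_const_mul _ ((measurable_deriv _).enorm.pow_const 2),
      ← lintegral_const_mul' _ _ ENNReal.ofReal_ne_top]
    refine le_trans ?_ (lintegral_mono_set hA)
    refine setLIntegral_mono' hAm fun t ht => ?_
    refine (mul_le_mul' ?_ le_rfl).trans_eq
      (by ring : (ENNReal.ofReal K * ENNReal.ofReal (w (T.edgePoint e t))) * _ = _)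
    have h1 := hw.card_mul_le hT hs (hA ht) (hAs t ht)
    rw [← ENNReal.ofReal_natCast, ← ENNReal.ofReal_natCast, ← ENNReal.ofReal_inv_of_pos hNe,
      ← ENNReal.ofReal_mul hNn.le, ← ENNReal.ofReal_mul (hw.weight.2 _).le,
      ← ENNReal.ofReal_mul hw.pos.le]
    apply ENNReal.ofReal_le_ofReal
    rw [← mul_assoc, ← div_eq_mul_inv, div_le_iff₀ hNe]
    linarith
  have hcancel : ((T.level n).card : ENNReal) * ((T.level n).card : ENNReal)⁻¹ = 1 :=
    ENNReal.mul_inv_cancel (by exact_mod_cast (T.level_card_pos n).ne') (by simp)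
  -- Hardy on the rest of the edge, from `s` to its far end; the factor `R` comes from `R - s ≤ R`.
  have hpt : ∀ e ∈ T.edgeLevel n, ‖u (T.edgePoint e s)‖ₑ ^ 2 *
        ENNReal.ofReal (w (T.edgePoint e s)) ≤ ENNReal.ofReal R * (ENNReal.ofReal w₀ *
        (‖u (T.vertexPoint e.1)‖ₑ ^ 2 / ENNReal.ofReal (R - T.height e.1)) +
        ENNReal.ofReal K * edgeEnergy w u e) := by
    intro e he
    have hse := hIoo e he
    have h1 := hu.edge_hardy hR e ⟨hse.1.le, hse.2⟩
    rw [ENNReal.div_le_iff (by simpa using hsR) ENNReal.ofReal_ne_top] at h1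
    have h2 : w (T.edgePoint e s) = w₀ := by
      apply hw.symm
      rw [(edgePoint_of_mem_Ioc e (Ioo_subset_Ioc_edge e hse)).2,
        (edgePoint_of_mem_Ioc e₀ (Ioo_subset_Ioc_edge e₀ hs)).2]
    rw [h2]
    have h3 := hE e (Ioo s (T.hi e)) (Ioo_subset_Ioo_left hse.1.le) measurableSet_Ioo
      fun t ht => ht.1.le
    rw [(T.mem_edgeLevel).mp he, hcancel, mul_one] at h3
    calc _ ≤ (_ * ENNReal.ofReal (R - s)) * ENNReal.ofReal w₀ := by gcongr
      _ = ENNReal.ofReal (R - s) * (ENNReal.ofReal w₀ * (‖u (T.vertexPoint e.1)‖ₑ ^ 2 /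
            ENNReal.ofReal (R - T.height e.1)) + ENNReal.ofReal w₀ *
            ∫⁻ t in Ioo s (T.hi e), ‖deriv (fun t => u (T.edgePoint e t)) t‖ₑ ^ 2) := by ring
      _ ≤ _ := by
          gcongr
          linarith [hse.1, T.lo_nonneg e]
  refine (Finset.sum_le_sum hpt).trans ?_
  rw [← Finset.mul_sum, Finset.sum_add_distrib, ← Finset.mul_sum, ENNReal.ofReal_mul hR0.le,
    mul_assoc]
  gcongr
  -- Writing the sum as `card (level n)` times an average admits `hM`; each resulting factor `w₀ *
  -- card (level n) / card (level m)` is absorbed by growth through `hE`.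
  have hX : ENNReal.ofReal w₀ * ∑ e ∈ T.edgeLevel n, ‖u (T.vertexPoint e.1)‖ₑ ^ 2 /
        ENNReal.ofReal (R - T.height e.1) ≤
      ∑ m ∈ Finset.Ico (n + 1) (n + 1 + M), ∑ e ∈ T.edgeLevel m,
        ENNReal.ofReal K * edgeEnergy w u e := by
    have h1 := T.sum_edgeLevel (fun v => ‖u (T.vertexPoint v)‖ₑ ^ 2 /
        ENNReal.ofReal (R - T.height v)) k
    rw [← hk] at h1
    rw [h1]
    calc _ = (ENNReal.ofReal w₀ * (T.level n).card) * (((T.level n).card : ENNReal)⁻¹ *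
          ∑ v ∈ T.level n, ‖u (T.vertexPoint v)‖ₑ ^ 2 / ENNReal.ofReal (R - T.height v)) := by
            rw [mul_assoc, ← mul_assoc ((T.level n).card : ENNReal), hcancel, one_mul]
      _ ≤ _ := mul_le_mul_right (hM n) _
      _ ≤ _ := by
          rw [Finset.mul_sum]
          refine Finset.sum_le_sum fun m hm => ?_
          rw [Finset.mul_sum, Finset.mul_sum]
          refine Finset.sum_le_sum fun e he => ?_
          rw [mem_edgeLevel] at he
          rw [Finset.mem_Ico] at hm
          have h2 := hE e _ subset_rfl measurableSet_Ioo fun t ht => by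
            have h3 := T.gen_of_ne_bot e.1 e.2
            have h4 : T.hi e₀ ≤ T.lo e := hT.height_le (by omega)
            exact hs.2.le.trans (h4.trans ht.1.le)
          rw [he] at h2
          refine le_trans (le_of_eq ?_) h2
          ring
  rw [← ENNReal.tsum_mul_left]
  -- Generation `n` contributes the partial edges of `hpt`, later generations those of `hX`; no edge
  -- is used twice.
  refine le_trans ?_ (sum_edgeLevel_le_tsum _ (Finset.Ico n (n + 1 + M)))
  rw [Finset.sum_eq_sum_Ico_succ_bot (by omega), add_comm]
  gcongr

/-- The bound on a sphere does not depend on `s`, so integration over the annulus only adds its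
thickness as a factor. -/
theorem IsTest.level_le [Infinite T.Vertex]
    {bc : RootCondition} {u : T.Point → ℂ} (hu : IsTest bc u)
    (hT : T.IsRadial) {R : ℝ} (hR : ∀ v, T.height v < R) {w : T.Point → ℝ} {c K : ℝ}
    (hw : IsGrowing w c K) (e₀ : T.Edge) :
    ∑ e ∈ T.edgeLevel (T.gen e₀.1), ∫⁻ t in Ioo (T.lo e) (T.hi e),
      ‖u (T.edgePoint e t)‖ₑ ^ 2 * ENNReal.ofReal (w (T.edgePoint e t)) ≤
      ENNReal.ofReal (T.hi e₀ - T.lo e₀) * (ENNReal.ofReal (R * K) * ∑' e, edgeEnergy w u e) := by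
  have h1 : ∀ e ∈ T.edgeLevel (T.gen e₀.1), ∫⁻ t in Ioo (T.lo e) (T.hi e),
      ‖u (T.edgePoint e t)‖ₑ ^ 2 * ENNReal.ofReal (w (T.edgePoint e t)) =
      ∫⁻ t in Ioo (T.lo e₀) (T.hi e₀),
      ‖u (T.edgePoint e t)‖ₑ ^ 2 * ENNReal.ofReal (w (T.edgePoint e t)) := by
    intro e he
    rw [mem_edgeLevel] at he
    rw [hT.lo_eq he, hT.hi_eq he]
  rw [Finset.sum_congr rfl h1, ← lintegral_finsetSum]
  · calc _ ≤ ∫⁻ t in Ioo (T.lo e₀) (T.hi e₀),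
          (ENNReal.ofReal (R * K) * ∑' e, edgeEnergy w u e) :=
          setLIntegral_mono' measurableSet_Ioo fun s hs => hu.sphere_le hT hR hw e₀ hs
      _ = _ := by
          rw [setLIntegral_const, Real.volume_Ioo, mul_comm]
  · intro e _
    have h2 := hu.measurable.comp (T.measurable_edgePoint e)
    have h3 := hw.weight.1.comp (T.measurable_edgePoint e)
    exact (h2.enorm.pow_const 2).mul h3.ennreal_ofReal

/-- The mass of a test function far from the root is small compared to its energy. -/
theorem exists_tail_le [Infinite T.Vertex] (hT : T.IsRadial) {R : ℝ} (hR : ∀ v, T.height v < R)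
    {w : T.Point → ℝ} {c K : ℝ} (hw : IsGrowing w c K) {ε : ℝ} (hε : 0 < ε) :
    ∃ N, ∀ (bc : RootCondition) (u : T.Point → ℂ), IsTest bc u →
      ∀ S : Finset T.Edge, (∀ e ∈ S, N < T.gen e.1) →
      ∑ e ∈ S, ∫⁻ t in Ioo (T.lo e) (T.hi e),
        ‖u (T.edgePoint e t)‖ₑ ^ 2 * ENNReal.ofReal (w (T.edgePoint e t)) ≤
        ENNReal.ofReal ε * ∑' e, edgeEnergy w u e := by
  classical
  choose v hv using T.exists_gen_eq
  have hmono : Monotone fun n => T.height (v n) := fun m n hmn =>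
    hT.height_le (by rw [hv, hv]; exact hmn)
  have hbdd : BddAbove (range fun n => T.height (v n)) :=
    ⟨R, by rintro _ ⟨n, rfl⟩; exact (hR _).le⟩
  have hR0 : 0 < R := (T.height_nonneg ⊥).trans_lt (hR ⊥)
  have hRK : 0 < R * K := mul_pos hR0 hw.pos
  have hcau := (tendsto_atTop_ciSup hmono hbdd).cauchySeq
  -- Finite radius enters here: the heights increase and are bounded, so beyond generation `N` the
  -- annuli have total thickness at most `ε / (R * K)`.
  obtain ⟨N, hN⟩ := Metric.cauchySeq_iff'.mp hcau (ε / (R * K)) (by positivity)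
  refine ⟨N, fun bc u hu S hS => ?_⟩
  set D := ∑' e, edgeEnergy w u e
  obtain ⟨M, hM⟩ := (S.finite_toSet.image fun e : T.Edge => T.gen e.1).bddAbove
  -- Edges of generation `m + 1` lie between the heights of generations `m` and `m + 1`, so the
  -- thicknesses telescope.
  have hind : ∀ k, ∑ m ∈ Finset.Ico N (N + k), ∑ e ∈ T.edgeLevel (m + 1),
      ∫⁻ t in Ioo (T.lo e) (T.hi e),
        ‖u (T.edgePoint e t)‖ₑ ^ 2 * ENNReal.ofReal (w (T.edgePoint e t)) ≤
      ENNReal.ofReal (T.height (v (N + k)) - T.height (v N)) * (ENNReal.ofReal (R * K) * D) := by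
    intro k
    induction k with
    | zero => simp
    | succ k ih =>
      rw [← add_assoc, Finset.sum_Ico_succ_top (by omega)]
      have hne : v (N + k + 1) ≠ ⊥ := by
        intro h
        have := hv (N + k + 1)
        rw [h, gen_bot] at this
        omega
      have h1 := hu.level_le hT hR hw ⟨v (N + k + 1), hne⟩
      have h2 : T.hi ⟨v (N + k + 1), hne⟩ = T.height (v (N + k + 1)) := rfl
      have h3 : T.lo ⟨v (N + k + 1), hne⟩ = T.height (v (N + k)) := by
        apply hT.height_eq
        have := T.gen_of_ne_bot _ hne
        rw [hv] at this ⊢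
        change T.gen (Order.pred (v (N + k + 1))) = _
        omega
      simp only [hv] at h1
      rw [h2, h3] at h1
      refine (add_le_add ih h1).trans_eq ?_
      rw [← add_mul, ← ENNReal.ofReal_add (sub_nonneg.mpr (hmono (by omega)))
        (sub_nonneg.mpr (hmono (by omega)))]
      congr 2
      ring
  have hsub : S ⊆ (Finset.Ico N (N + M)).biUnion fun m => T.edgeLevel (m + 1) := by
    intro e he
    have h1 := hS e he
    have h2 : T.gen e.1 ≤ M := hM ⟨e, he, rfl⟩
    rw [Finset.mem_biUnion]
    refine ⟨T.gen e.1 - 1, ?_, ?_⟩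
    · rw [Finset.mem_Ico]; omega
    · rw [mem_edgeLevel]; omega
  refine (Finset.sum_le_sum_of_subset hsub).trans ?_
  rw [Finset.sum_biUnion]
  · refine (hind M).trans ?_
    rw [← mul_assoc, ← ENNReal.ofReal_mul (sub_nonneg.mpr (hmono (by omega)))]
    gcongr
    have h1 := hN (N + M) (by omega)
    rw [Real.dist_eq] at h1
    have h2 := (le_abs_self _).trans h1.le
    rwa [le_div_iff₀ hRK] at h2
  · intro a _ b _ hab
    rw [Function.onFun, Finset.disjoint_left]
    intro e he he'
    rw [mem_edgeLevel] at he he'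
    omega

/-! ### Test functions as elements of the weighted spaces. -/

theorem edgePoint_mem_edgeSet {e f : T.Edge} {t : ℝ} (ht : t ∈ Ioo (T.lo e) (T.hi e))
    (h : T.edgePoint e t ∈ T.edgeSet f) : f = e := by
  obtain ⟨s, hs, hst⟩ := h
  obtain ⟨h1, h2⟩ := edgePoint_of_mem_Ioc e (Ioo_subset_Ioc_edge e ht)
  rcases hs.1.eq_or_lt with h3 | h3
  · exfalso
    rw [edgePoint_of_le_lo f h3.symm.le] at hst
    have h4 : Order.pred f.1 = e.1 := by rw [← h1, ← hst]; rfl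
    have h5 : T.height (Order.pred f.1) = t := by
      rw [← h2, ← hst]; rfl
    rw [h4] at h5
    exact ht.2.ne h5.symm
  · have h4 := (edgePoint_of_mem_Ioc f ⟨h3, hs.2⟩).1
    rw [hst, h1] at h4
    exact Subtype.ext h4.symm

/-- A property that holds in the interior of all edges holds almost everywhere. -/
theorem ae_weighted_of_edges {ρ : T.Point → ℝ} (hρ : Measurable ρ) {P : T.Point → Prop}
    (h : ∀ e : T.Edge, ∀ t ∈ Ioo (T.lo e) (T.hi e), P (T.edgePoint e t)) :
    ∀ᵐ x ∂(weighted ρ), P x := by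
  -- `E` consists of the points that are not vertices. It is measurable, since there are countably
  -- many edges, while `P` need not be.
  set E : Set T.Point := ⋃ e : T.Edge, {x | x.top = e.1} ∩ {x | x.abs < T.hi e}
  have hE : MeasurableSet E := MeasurableSet.iUnion fun e =>
    (measurableSet_top_eq e.1).inter (measurableSet_lt measurable_abs measurable_const)
  have h0 : weighted ρ Eᶜ = 0 := by
    rw [← lintegral_indicator_one hE.compl,
      lintegral_weighted hρ (measurable_one.indicator hE.compl), ENNReal.tsum_eq_zero]
    intro e
    rw [setLIntegral_congr_fun measurableSet_Ioo (g := fun _ => 0), lintegral_zero]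
    intro t ht
    obtain ⟨h1, h2⟩ := edgePoint_of_mem_Ioc e (Ioo_subset_Ioc_edge e ht)
    have h3 : T.edgePoint e t ∉ Eᶜ := by
      rw [mem_compl_iff, not_not, mem_iUnion]
      exact ⟨e, h1, by rw [mem_ofPred_eq, h2]; exact ht.2⟩
    simp [indicator_of_notMem h3]
  refine Filter.mem_of_superset (compl_mem_ae_iff.mpr h0) ?_
  rw [compl_compl]
  intro x hx
  obtain ⟨e, h1, h2⟩ := mem_iUnion.mp hx
  have h3 : T.lo e < x.abs := by
    rcases x.lt_abs with h4 | h4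
    · rw [lo, ← show x.top = e.1 from h1]; exact h4
    · exact absurd (h1.symm.trans h4.1) e.2
  have h4 := h e x.abs ⟨h3, h2⟩
  have h5 : T.edgePoint e x.abs = x := by
    obtain ⟨h6, h7⟩ := edgePoint_of_mem_Ioc e ⟨h3, le_of_lt h2⟩
    exact Point.ext (h6.trans h1.symm) h7
  rwa [h5] at h4

theorem lintegral_enorm_sq_edge_lt_top {w : T.Point → ℝ} {c : ℝ} (hw : ∀ x, w x ≤ c) (e : T.Edge)
    {φ : T.Point → ℂ} {B : ℝ} (hB : ∀ t ∈ Ioo (T.lo e) (T.hi e), ‖φ (T.edgePoint e t)‖ ≤ B) :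
    ∫⁻ t in Ioo (T.lo e) (T.hi e), ‖φ (T.edgePoint e t)‖ₑ ^ 2 *
      ENNReal.ofReal (w (T.edgePoint e t)) < ⊤ := by
  calc _ ≤ ∫⁻ t in Ioo (T.lo e) (T.hi e), ENNReal.ofReal B ^ 2 * ENNReal.ofReal c := by
        refine setLIntegral_mono' measurableSet_Ioo fun t ht => ?_
        rw [← ofReal_norm]
        gcongr
        · exact hB t ht
        · exact hw _
    _ < ⊤ := by
        rw [setLIntegral_const, Real.volume_Ioo]
        exact ENNReal.mul_lt_top (ENNReal.mul_lt_top (ENNReal.pow_lt_top ENNReal.ofReal_lt_top)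
          ENNReal.ofReal_lt_top) ENNReal.ofReal_lt_top

/-- A function which is bounded on each edge and vanishes off finitely many edges is square
integrable with respect to a bounded weight. -/
theorem memLp_of_bounded_on_edges {w : T.Point → ℝ} (hwm : Measurable w) {c : ℝ}
    (hw : ∀ x, w x ≤ c) {φ : T.Point → ℂ} (hφ : Measurable φ) {F : Set T.Edge} (hF : F.Finite)
    (h0 : ∀ e ∉ F, ∀ t ∈ Ioo (T.lo e) (T.hi e), φ (T.edgePoint e t) = 0)
    (hB : ∀ e, ∃ B : ℝ, ∀ t ∈ Ioo (T.lo e) (T.hi e), ‖φ (T.edgePoint e t)‖ ≤ B) :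
    MemLp φ 2 (weighted w) := by
  refine ⟨hφ.aestronglyMeasurable, ?_⟩
  have h := eLpNorm_nnreal_pow_eq_lintegral (f := φ) (μ := weighted w) (p := 2) (by norm_num)
  norm_num at h
  have h1 : eLpNorm φ 2 (weighted w) ^ 2 < ⊤ := by
    rw [h, lintegral_weighted hwm (hφ.enorm.pow_const 2), tsum_eq_sum (s := hF.toFinset)]
    · rw [ENNReal.sum_lt_top]
      intro e _
      obtain ⟨B, hB⟩ := hB e
      exact lintegral_enorm_sq_edge_lt_top hw e hB
    · intro e he
      rw [setLIntegral_congr_fun measurableSet_Ioo (g := fun _ => 0), lintegral_zero]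
      intro t ht
      simp [h0 e (by simpa using he) t ht]
  by_contra h2
  rw [not_lt, top_le_iff] at h2
  rw [h2] at h1
  simp at h1

theorem IsTest.zero_off {bc : RootCondition} {u : T.Point → ℂ} (hu : IsTest bc u) :
    ∃ F : Set T.Edge, F.Finite ∧
      ∀ e ∉ F, ∀ t ∈ Ioo (T.lo e) (T.hi e), u (T.edgePoint e t) = 0 := by
  obtain ⟨F, hF, h⟩ := hu.compact_support
  refine ⟨F, hF, fun e he t ht => h _ fun f hf hmem => ?_⟩
  rw [edgePoint_mem_edgeSet ht hmem] at hf
  exact he hf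

theorem IsTest.memLp {bc : RootCondition} {u : T.Point → ℂ} (hu : IsTest bc u)
    {w : T.Point → ℝ} (hwm : Measurable w) {c : ℝ} (hw : ∀ x, w x ≤ c) :
    MemLp u 2 (weighted w) := by
  obtain ⟨F, hF, h⟩ := hu.zero_off
  refine memLp_of_bounded_on_edges hwm hw hu.measurable hF h fun e => ?_
  obtain ⟨B, hB⟩ := isCompact_Icc.exists_bound_of_continuousOn (hu.continuousOn e)
  exact ⟨B, fun t ht => hB t (Ioo_subset_Icc_self ht)⟩

theorem IsTest.memLp_edgeDeriv {bc : RootCondition} {u : T.Point → ℂ} (hu : IsTest bc u)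
    {w : T.Point → ℝ} (hwm : Measurable w) {c : ℝ} (hw : ∀ x, w x ≤ c) :
    MemLp (edgeDeriv u) 2 (weighted w) := by
  obtain ⟨F, hF, h⟩ := hu.zero_off
  refine memLp_of_bounded_on_edges hwm hw (measurable_edgeDeriv u) hF (fun e he t ht => ?_)
    fun e => ?_
  · rw [edgeDeriv_edgePoint u e (Ioo_subset_Ioc_edge e ht)]
    have h1 : (fun t => u (T.edgePoint e t)) =ᶠ[𝓝 t] fun _ => 0 := by
      filter_upwards [isOpen_Ioo.mem_nhds ht] with s hs using h e he s hs
    rw [h1.deriv_eq, deriv_const]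
  -- Being `C¹` up to the endpoints makes the derivative bounded on the edge.
  · have h1 := ((hu.contDiffOn e).derivWithin (m := 0) (uniqueDiffOn_Icc (T.lo_lt_hi e))
      (by simp)).continuousOn
    obtain ⟨B, hB⟩ := isCompact_Icc.exists_bound_of_continuousOn h1
    refine ⟨B, fun t ht => ?_⟩
    rw [edgeDeriv_edgePoint u e (Ioo_subset_Ioc_edge e ht),
      ← derivWithin_of_mem_nhds (Icc_mem_nhds ht.1 ht.2)]
    exact hB t (Ioo_subset_Icc_self ht)

theorem IsTest.differentiableAt {bc : RootCondition} {u : T.Point → ℂ} (hu : IsTest bc u)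
    (e : T.Edge) {t : ℝ} (ht : t ∈ Ioo (T.lo e) (T.hi e)) :
    DifferentiableAt ℝ (fun t => u (T.edgePoint e t)) t :=
  ((hu.contDiffOn e t (Ioo_subset_Icc_self ht)).differentiableWithinAt one_ne_zero).differentiableAt
    (Icc_mem_nhds ht.1 ht.2)

theorem IsTest.add {bc : RootCondition} {u v : T.Point → ℂ} (hu : IsTest bc u)
    (hv : IsTest bc v) : IsTest bc (u + v) where
  contDiffOn e := (hu.contDiffOn e).add (hv.contDiffOn e)
  compact_support := by
    obtain ⟨F, hF, hu0⟩ := hu.compact_support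
    obtain ⟨G, hG, hv0⟩ := hv.compact_support
    refine ⟨F ∪ G, hF.union hG, fun x hx => ?_⟩
    rw [Pi.add_apply, hu0 x fun e he => hx e (Or.inl he), hv0 x fun e he => hx e (Or.inr he),
      add_zero]
  root h := by rw [Pi.add_apply, hu.root h, hv.root h, add_zero]

theorem IsTest.smul {bc : RootCondition} {u : T.Point → ℂ} (hu : IsTest bc u) (a : ℂ) :
    IsTest bc (a • u) where
  contDiffOn e := (hu.contDiffOn e).const_smul a
  compact_support := by
    obtain ⟨F, hF, hu0⟩ := hu.compact_support
    refine ⟨F, hF, fun x hx => ?_⟩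
    rw [Pi.smul_apply, hu0 x hx, smul_zero]
  root h := by rw [Pi.smul_apply, hu.root h, smul_zero]

theorem isTest_zero (bc : RootCondition) : IsTest (T := T) bc 0 where
  contDiffOn _ := contDiffOn_const
  compact_support := ⟨∅, finite_empty, fun _ _ => rfl⟩
  root _ := rfl

/-- Only almost everywhere: at vertices the constantly extended parametrization may fail to be
differentiable, and `deriv` is then zero by default. -/
theorem edgeDeriv_add {ρ : T.Point → ℝ} (hρ : Measurable ρ) {bc : RootCondition}
    {u v : T.Point → ℂ} (hu : IsTest bc u) (hv : IsTest bc v) :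
    edgeDeriv (u + v) =ᵐ[weighted ρ] edgeDeriv u + edgeDeriv v := by
  refine ae_weighted_of_edges hρ fun e t ht => ?_
  have ht' := Ioo_subset_Ioc_edge e ht
  rw [Pi.add_apply, edgeDeriv_edgePoint _ e ht', edgeDeriv_edgePoint _ e ht',
    edgeDeriv_edgePoint _ e ht']
  exact deriv_add (hu.differentiableAt e ht) (hv.differentiableAt e ht)

theorem edgeDeriv_smul {ρ : T.Point → ℝ} (hρ : Measurable ρ) {bc : RootCondition}
    {u : T.Point → ℂ} (hu : IsTest bc u) (a : ℂ) :
    edgeDeriv (a • u) =ᵐ[weighted ρ] a • edgeDeriv u := by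
  refine ae_weighted_of_edges hρ fun e t ht => ?_
  have ht' := Ioo_subset_Ioc_edge e ht
  rw [Pi.smul_apply, edgeDeriv_edgePoint _ e ht', edgeDeriv_edgePoint _ e ht']
  exact deriv_const_smul a (hu.differentiableAt e ht)

/-- The pairs `(u, u')` with `u` in `C^1_0` form a subspace. -/
theorem span_test {ρ : T.Point → ℝ} (hρ : Measurable ρ) (bc : RootCondition) :
    (Submodule.span ℂ {p : L2 ρ × L2 ρ | ∃ u : T.Point → ℂ, IsTest bc u ∧
      p.1 =ᵐ[weighted ρ] u ∧ p.2 =ᵐ[weighted ρ] edgeDeriv u} : Set (L2 ρ × L2 ρ)) =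
    {p : L2 ρ × L2 ρ | ∃ u : T.Point → ℂ, IsTest bc u ∧
      p.1 =ᵐ[weighted ρ] u ∧ p.2 =ᵐ[weighted ρ] edgeDeriv u} := by
  refine Subset.antisymm (fun p hp => ?_) Submodule.subset_span
  refine Submodule.span_induction (fun x hx => hx) ?_ ?_ ?_ hp
  · refine ⟨0, isTest_zero bc, Lp.coeFn_zero ℂ 2 _, (Lp.coeFn_zero ℂ 2 _).trans ?_⟩
    refine ae_weighted_of_edges hρ fun e t ht => ?_
    rw [edgeDeriv_edgePoint _ e (Ioo_subset_Ioc_edge e ht)]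
    simp
  · rintro x y - - ⟨u, hu, hu1, hu2⟩ ⟨v, hv, hv1, hv2⟩
    exact ⟨u + v, hu.add hv, (Lp.coeFn_add _ _).trans (hu1.add hv1),
      (Lp.coeFn_add _ _).trans ((hu2.add hv2).trans (edgeDeriv_add hρ hu hv).symm)⟩
  · rintro a x - ⟨u, hu, hu1, hu2⟩
    exact ⟨a • u, hu.smul a, (Lp.coeFn_smul _ _).trans (hu1.const_smul a),
      (Lp.coeFn_smul _ _).trans ((hu2.const_smul a).trans (edgeDeriv_smul hρ hu a).symm)⟩

theorem weighted_top_eq_lt_top {w : T.Point → ℝ} (hwm : Measurable w) {c : ℝ}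
    (hw : ∀ x, w x ≤ c) (e : T.Edge) : weighted w {x | x.top = e.1} < ⊤ := by
  classical
  have hm := measurableSet_top_eq e.1
  have h : MemLp ({x : T.Point | x.top = e.1}.indicator fun _ => (1 : ℂ)) 2 (weighted w) := by
    refine memLp_of_bounded_on_edges hwm hw (measurable_const.indicator hm) (finite_singleton e)
      (fun f hf t ht => ?_) fun f => ⟨1, fun t _ => ?_⟩
    · apply indicator_of_notMem
      rw [mem_ofPred_eq, (edgePoint_of_mem_Ioc f (Ioo_subset_Ioc_edge f ht)).1]
      exact fun h => hf (Subtype.ext h)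
    · by_cases hx : T.edgePoint f t ∈ {x : T.Point | x.top = e.1} <;> simp [indicator, hx]
  refine SimpleFunc.measure_lt_top_of_memLp_indicator two_ne_zero ENNReal.ofNat_ne_top
    (one_ne_zero (α := ℂ)) hm ?_
  convert! h using 1

/-- On one edge a test function is close to the step function of its values at the points
`lo e + d * i`. -/
theorem IsGrowing.exists_step_le [Infinite T.Vertex] {w : T.Point → ℝ} {c K : ℝ}
    (hw : IsGrowing w c K) (hT : T.IsRadial) (e : T.Edge) {ε : ℝ} (hε : 0 < ε) :
    ∃ d : ℝ, 0 < d ∧ ∀ (bc : RootCondition) (u : T.Point → ℂ), IsTest bc u →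
      ∫⁻ t in Ioo (T.lo e) (T.hi e), ‖u (T.edgePoint e t) -
        u (T.edgePoint e (T.lo e + d * ⌊(t - T.lo e) / d⌋₊))‖ₑ ^ 2 *
          ENNReal.ofReal (w (T.edgePoint e t)) ≤ ENNReal.ofReal ε * edgeEnergy w u e := by
  obtain ⟨κ, hκ, hκw⟩ := hw.exists_lower_bound hT e
  have hl : 0 < T.hi e - T.lo e := sub_pos.mpr (T.lo_lt_hi e)
  have hc : 0 < c := (hw.weight.2 (T.vertexPoint ⊥)).trans_le (hw.le _)
  -- Within a cell of length `d` the squared oscillation is at most `d` times the unweighted energy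
  -- `I`. With `w ≤ c` integration gives `d * c * (hi - lo) * I = ε * κ * I`, and `κ ≤ w` restores
  -- the weight.
  refine ⟨ε * κ / (c * (T.hi e - T.lo e)), by positivity, fun bc u hu => ?_⟩
  set d := ε * κ / (c * (T.hi e - T.lo e)) with hd
  have hd0 : 0 < d := by positivity
  set I := ∫⁻ t in Ioo (T.lo e) (T.hi e), ‖deriv (fun t => u (T.edgePoint e t)) t‖ₑ ^ 2
  have h1 : ∀ t ∈ Ioo (T.lo e) (T.hi e), ‖u (T.edgePoint e t) -
        u (T.edgePoint e (T.lo e + d * ⌊(t - T.lo e) / d⌋₊))‖ₑ ^ 2 *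
          ENNReal.ofReal (w (T.edgePoint e t)) ≤ ENNReal.ofReal d * I * ENNReal.ofReal c := by
    intro t ht
    have h2 : (0 : ℝ) ≤ (t - T.lo e) / d := div_nonneg (sub_nonneg.mpr ht.1.le) hd0.le
    have h3 := Nat.floor_le h2
    have h4 := Nat.lt_floor_add_one ((t - T.lo e) / d)
    rw [le_div_iff₀ hd0] at h3
    rw [div_lt_iff₀ hd0] at h4
    set i : ℝ := ((⌊(t - T.lo e) / d⌋₊ : ℕ) : ℝ)
    have hi0 : 0 ≤ d * i := by positivity
    have h5 := enorm_sub_sq_le (hu.contDiffOn e) (s := T.lo e + d * i) (r := t)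
      (by linarith) (by linarith) ht.2.le
    have h6 : Ioo (T.lo e + d * i) t ⊆ Ioo (T.lo e) (T.hi e) :=
      Ioo_subset_Ioo (by linarith) ht.2.le
    have h7 : t - (T.lo e + d * i) ≤ d := by linarith
    have h8 := lintegral_mono_set (μ := volume)
      (f := fun t => ‖deriv (fun t => u (T.edgePoint e t)) t‖ₑ ^ 2) h6
    calc _ ≤ (ENNReal.ofReal (t - (T.lo e + d * i)) * _) * ENNReal.ofReal c := by
          gcongr
          exact hw.le _
      _ ≤ _ := by gcongr
  refine (setLIntegral_mono' measurableSet_Ioo h1).trans ?_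
  rw [setLIntegral_const, Real.volume_Ioo]
  have h2 : ENNReal.ofReal d * I * ENNReal.ofReal c * ENNReal.ofReal (T.hi e - T.lo e) =
      ENNReal.ofReal ε * (ENNReal.ofReal κ * I) := by
    calc _ = (ENNReal.ofReal d * ENNReal.ofReal c * ENNReal.ofReal (T.hi e - T.lo e)) * I := by
          ring
      _ = (ENNReal.ofReal ε * ENNReal.ofReal κ) * I := by
          rw [← ENNReal.ofReal_mul hd0.le, ← ENNReal.ofReal_mul (by positivity),
            ← ENNReal.ofReal_mul hε.le]
          congr 2
          rw [hd]
          field_simp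
      _ = _ := by ring
  rw [h2]
  gcongr
  rw [edgeEnergy, ← lintegral_const_mul' _ _ ENNReal.ofReal_ne_top]
  refine setLIntegral_mono' measurableSet_Ioo fun t ht => ?_
  rw [mul_comm]
  gcongr
  exact hκw t ht

/-- Test functions are approximated, uniformly with respect to their energy, by a
finite-dimensional space. -/
theorem exists_finiteDimensional_approx [Infinite T.Vertex] (hT : T.IsRadial) {R : ℝ}
    (hR : ∀ v, T.height v < R) {w : T.Point → ℝ} {c K : ℝ} (hw : IsGrowing w c K)
    (bc : RootCondition) {ε : ℝ} (hε : 0 < ε) :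
    ∃ F : Submodule ℂ (L2 w), FiniteDimensional ℂ F ∧ ∀ u : T.Point → ℂ, IsTest bc u →
      ∀ p q : L2 w, p =ᵐ[weighted w] u → q =ᵐ[weighted w] edgeDeriv u →
        ∃ f ∈ F, ‖p - f‖ ≤ ε * ‖q‖ := by
  classical
  -- One half of `ε²` is spent on the generations up to `N`, the other on the tail.
  have hε2 : 0 < ε ^ 2 / 2 := by positivity
  obtain ⟨N, hN⟩ := exists_tail_le hT hR hw hε2
  choose d hd0 hd using fun e : T.Edge => hw.exists_step_le hT e hε2
  set G : Finset T.Edge := (Finset.range (N + 1)).biUnion T.edgeLevel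
  have hG : ∀ e, e ∈ G ↔ T.gen e.1 ≤ N := by
    intro e
    simp [G]
  set J : Finset (Σ _ : T.Edge, ℕ) :=
    G.sigma fun e => Finset.range (⌊(T.hi e - T.lo e) / d e⌋₊ + 1)
  set S : (Σ _ : T.Edge, ℕ) → Set T.Point := fun i =>
    {x | x.top = i.1.1} ∩ {x | ⌊(x.abs - T.lo i.1) / d i.1⌋₊ = i.2}
  have hS : ∀ i, MeasurableSet (S i) := by
    intro i
    refine (measurableSet_top_eq _).inter ?_
    exact (Nat.measurable_floor.comp ((measurable_abs.sub_const _).div_const _))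
      (measurableSet_singleton i.2)
  have hμ : ∀ i, weighted w (S i) ≠ ⊤ := fun i =>
    ((measure_mono inter_subset_left).trans_lt
      (weighted_top_eq_lt_top hw.weight.1 hw.le i.1)).ne
  -- The cells are fixed before `u`, so one space `F` serves all test functions.
  obtain ⟨F, hF, hFS⟩ := exists_finiteDimensional_step (weighted w) J S hS hμ
  refine ⟨F, hF, fun u hu p q hp hq => ?_⟩
  obtain ⟨f, hf, hfu⟩ := hFS fun i => u (T.edgePoint i.1 (T.lo i.1 + d i.1 * i.2))
  refine ⟨f, hf, ?_⟩
  set g : T.Point → ℂ := fun x => ∑ i ∈ J, (S i).indicator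
    (fun _ => u (T.edgePoint i.1 (T.lo i.1 + d i.1 * i.2))) x with hg
  have hgm : Measurable g :=
    Finset.measurable_fun_sum _ fun i _ => measurable_const.indicator (hS i)
  have hmem : ∀ (e : T.Edge), ∀ t ∈ Ioo (T.lo e) (T.hi e), ∀ i, T.edgePoint e t ∈ S i ↔
      i = ⟨e, ⌊(t - T.lo e) / d e⌋₊⟩ := by
    rintro e t ht ⟨e', i⟩
    obtain ⟨h1, h2⟩ := edgePoint_of_mem_Ioc e (Ioo_subset_Ioc_edge e ht)
    simp only [S, mem_inter_iff, mem_ofPred_eq, h1, h2]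
    constructor
    · rintro ⟨h3, h4⟩
      obtain rfl : e' = e := Subtype.ext h3.symm
      rw [h4]
    · intro h
      obtain ⟨rfl, h4⟩ := Sigma.mk.inj_iff.mp h
      exact ⟨rfl, (eq_of_heq h4).symm⟩
  have hg_in : ∀ e ∈ G, ∀ t ∈ Ioo (T.lo e) (T.hi e), g (T.edgePoint e t) =
      u (T.edgePoint e (T.lo e + d e * ⌊(t - T.lo e) / d e⌋₊)) := by
    intro e he t ht
    rw [hg]
    dsimp only
    rw [Finset.sum_eq_single (⟨e, ⌊(t - T.lo e) / d e⌋₊⟩ : Σ _ : T.Edge, ℕ)]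
    · rw [indicator_of_mem ((hmem e t ht _).mpr rfl)]
    · intro i _ hi
      exact indicator_of_notMem (fun h => hi ((hmem e t ht i).mp h)) _
    · intro h
      exfalso
      apply h
      rw [Finset.mem_sigma, Finset.mem_range, Nat.lt_succ_iff]
      refine ⟨he, Nat.floor_mono ?_⟩
      have := hd0 e
      have := ht.2.le
      gcongr
  have hg_out : ∀ e ∉ G, ∀ t ∈ Ioo (T.lo e) (T.hi e), g (T.edgePoint e t) = 0 := by
    intro e he t ht
    refine Finset.sum_eq_zero fun i hi => indicator_of_notMem (fun h => ?_) _
    rw [(hmem e t ht i).mp h, Finset.mem_sigma] at hi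
    exact he hi.1
  set D := ∑' e, edgeEnergy w u e
  have hpf : ((p - f : L2 w) : T.Point → ℂ) =ᵐ[weighted w] fun x => u x - g x := by
    filter_upwards [Lp.coeFn_sub p f, hp, hfu] with x h1 h2 h3
    rw [h1, Pi.sub_apply, h2, h3]
  have hle : ‖p - f‖ₑ ^ 2 ≤ ENNReal.ofReal (ε ^ 2) * ‖q‖ₑ ^ 2 := by
    have hm : Measurable fun x => ‖u x - g x‖ₑ ^ 2 := (hu.measurable.sub hgm).enorm.pow_const 2
    rw [enorm_sq_eq_lintegral _ hpf, enorm_sq_eq_lintegral _ hq,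
      lintegral_edgeDeriv hw.weight.1, lintegral_weighted hw.weight.1 hm, ENNReal.tsum_eq_iSup_sum]
    refine iSup_le fun A => ?_
    rw [← Finset.sum_filter_add_sum_filter_not A (fun e => e ∈ G)]
    have h1 : ∑ e ∈ A.filter (fun e => e ∈ G), ∫⁻ t in Ioo (T.lo e) (T.hi e),
        ‖u (T.edgePoint e t) - g (T.edgePoint e t)‖ₑ ^ 2 * ENNReal.ofReal (w (T.edgePoint e t)) ≤
        ENNReal.ofReal (ε ^ 2 / 2) * D := by
      refine (Finset.sum_le_sum fun e he => ?_).trans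
        (((ENNReal.sum_le_tsum (A.filter (fun e => e ∈ G)))).trans_eq ENNReal.tsum_mul_left)
      refine le_trans (le_of_eq ?_) (hd e bc u hu)
      refine setLIntegral_congr_fun measurableSet_Ioo fun t ht => ?_
      simp only [hg_in e (Finset.mem_filter.mp he).2 t ht]
    have h2 : ∑ e ∈ A.filter (fun e => e ∉ G), ∫⁻ t in Ioo (T.lo e) (T.hi e),
        ‖u (T.edgePoint e t) - g (T.edgePoint e t)‖ₑ ^ 2 * ENNReal.ofReal (w (T.edgePoint e t)) ≤
        ENNReal.ofReal (ε ^ 2 / 2) * D := by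
      refine le_trans (le_of_eq (Finset.sum_congr rfl fun e he => ?_))
        (hN bc u hu (A.filter (fun e => e ∉ G)) fun e he => ?_)
      · refine setLIntegral_congr_fun measurableSet_Ioo fun t ht => ?_
        simp only [hg_out e (Finset.mem_filter.mp he).2 t ht, sub_zero]
      · have := (Finset.mem_filter.mp he).2
        rw [hG] at this
        omega
    refine (add_le_add h1 h2).trans_eq ?_
    rw [← add_mul, ← ENNReal.ofReal_add hε2.le hε2.le, add_halves]
  rw [← ofReal_norm, ← ofReal_norm, ← ENNReal.ofReal_pow (norm_nonneg _),
    ← ENNReal.ofReal_pow (norm_nonneg _), ← ENNReal.ofReal_mul (by positivity),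
    ENNReal.ofReal_le_ofReal_iff (by positivity), ← mul_pow] at hle
  exact le_of_sq_le_sq hle (by positivity)

end MetricTree

/-! ### Multiplication operators on `L²`. -/

/-- Multiplication by an essentially bounded real function. -/
theorem exists_mul_operator {α : Type*} [MeasurableSpace α] {μ : Measure α} {m : α → ℝ}
    (hm : MemLp m ⊤ μ) : ∃ M : Lp ℂ 2 μ →L[ℂ] Lp ℂ 2 μ,
      ∀ f, M f =ᵐ[μ] fun x => (m x : ℂ) * f x := by
  have hm' : MemLp (fun x => (m x : ℂ)) ⊤ μ := hm.ofReal
  refine ⟨(ContinuousLinearMap.mul ℂ ℂ).holderL μ ⊤ 2 2 hm'.toLp, fun f => ?_⟩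
  filter_upwards [(ContinuousLinearMap.mul ℂ ℂ).coeFn_holder (r := 2) hm'.toLp f,
    hm'.coeFn_toLp] with x h1 h2
  rw [ContinuousLinearMap.holderL_apply_apply, h1, h2]
  rfl

theorem inner_mul_operator {α : Type*} [MeasurableSpace α] {μ : Measure α} {m : α → ℝ}
    {M : Lp ℂ 2 μ →L[ℂ] Lp ℂ 2 μ} (hM : ∀ f, M f =ᵐ[μ] fun x => (m x : ℂ) * f x)
    (f g : Lp ℂ 2 μ) :
    Integrable (fun x => (m x : ℂ) * g x * (starRingEnd ℂ) (f x)) μ ∧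
      inner ℂ f (M g) = ∫ x, (m x : ℂ) * g x * (starRingEnd ℂ) (f x) ∂μ := by
  have h : (fun x => inner ℂ (f x) (M g x)) =ᵐ[μ]
      fun x => (m x : ℂ) * g x * (starRingEnd ℂ) (f x) := by
    filter_upwards [hM g] with x hx
    rw [hx, RCLike.inner_apply]
  exact ⟨(L2.integrable_inner f (M g)).congr h, by rw [L2.inner_def, integral_congr_ae h]⟩

theorem mul_operator_symm {α : Type*} [MeasurableSpace α] {μ : Measure α} {m : α → ℝ}
    {M : Lp ℂ 2 μ →L[ℂ] Lp ℂ 2 μ} (hM : ∀ f, M f =ᵐ[μ] fun x => (m x : ℂ) * f x)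
    (f g : Lp ℂ 2 μ) : inner ℂ (M f) g = inner ℂ f (M g) := by
  rw [← inner_conj_symm, (inner_mul_operator hM g f).2, (inner_mul_operator hM f g).2,
    ← integral_conj]
  refine integral_congr_ae (Filter.Eventually.of_forall fun x => ?_)
  simp only [map_mul, Complex.conj_ofReal, Complex.conj_conj]
  ring

theorem mul_norm_sq_le_inner {α : Type*} [MeasurableSpace α] {μ : Measure α} {m : α → ℝ}
    {M : Lp ℂ 2 μ →L[ℂ] Lp ℂ 2 μ} (hM : ∀ f, M f =ᵐ[μ] fun x => (m x : ℂ) * f x)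
    {k : ℝ} (hk : ∀ x, k ≤ m x) (f : Lp ℂ 2 μ) : k * ‖f‖ ^ 2 ≤ (inner ℂ f (M f)).re := by
  obtain ⟨h1, h2⟩ := inner_mul_operator hM f f
  have h3 : (‖f‖ ^ 2 : ℝ) = (inner ℂ f f : ℂ).re := by
    rw [inner_self_eq_norm_sq_to_K]
    norm_cast
  have h4 : ∀ x, (m x : ℂ) * f x * (starRingEnd ℂ) (f x) = ((m x * ‖f x‖ ^ 2 : ℝ) : ℂ) := by
    intro x
    rw [mul_assoc, Complex.mul_conj']
    push_cast
    rfl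
  have h5 : ∀ x, inner ℂ (f x) (f x) = ((‖f x‖ ^ 2 : ℝ) : ℂ) := by
    intro x
    rw [inner_self_eq_norm_sq_to_K]
    norm_cast
  have h6 := L2.integrable_inner (𝕜 := ℂ) f f
  simp only [h4] at h1 h2
  rw [h3, h2, L2.inner_def]
  simp only [h5] at h6 ⊢
  have h7 : Integrable (fun x => m x * ‖f x‖ ^ 2) μ := by
    exact h1.re
  have h8 : Integrable (fun x => ‖f x‖ ^ 2) μ := by
    exact h6.re
  rw [integral_complex_ofReal, integral_complex_ofReal, Complex.ofReal_re, Complex.ofReal_re,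
    ← integral_const_mul]
  exact integral_mono (h8.const_mul k) h7 fun x => by
    dsimp only
    gcongr
    exact hk x

/-! ### Density of the test functions. -/

namespace MetricTree

variable {T : MetricTree}

/-- Identifies one edge with a weighted interval, so that Bochner integrals, and not only
`lintegral`, can be moved to the line. -/
theorem restrict_top_eq {w : T.Point → ℝ} (hw : Measurable w) (e : T.Edge) :
    (weighted w).restrict {x | x.top = e.1} =
      ((volume.restrict (Ioo (T.lo e) (T.hi e))).withDensity
        fun t => ENNReal.ofReal (w (T.edgePoint e t))).map (T.edgePoint e) := by
  ext A hA
  have hm := hA.inter (measurableSet_top_eq e.1)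
  rw [Measure.restrict_apply hA, Measure.map_apply (T.measurable_edgePoint e) hA,
    withDensity_apply _ (T.measurable_edgePoint e hA), ← lintegral_indicator_one hm,
    lintegral_weighted hw (measurable_one.indicator hm), tsum_eq_single e,
    ← lintegral_indicator (T.measurable_edgePoint e hA)]
  · refine setLIntegral_congr_fun measurableSet_Ioo fun t ht => ?_
    have h1 := (edgePoint_of_mem_Ioc e (Ioo_subset_Ioc_edge e ht)).1
    by_cases hx : T.edgePoint e t ∈ A <;> simp [indicator, h1, hx]
  · intro f hf
    rw [setLIntegral_congr_fun measurableSet_Ioo (g := fun _ => 0), lintegral_zero]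
    intro t ht
    have h1 := (edgePoint_of_mem_Ioc f (Ioo_subset_Ioc_edge f ht)).1
    have h2 : f.1 ≠ e.1 := fun h => hf (Subtype.ext h)
    simp [indicator, h1, h2]

theorem integral_weighted_edge {w : T.Point → ℝ} (hw : IsWeight w) (e : T.Edge)
    {h : T.Point → ℂ} (hm : Measurable h) (h0 : ∀ x : T.Point, x.top ≠ e.1 → h x = 0) :
    ∫ x, h x ∂(weighted w) =
      ∫ t in Ioo (T.lo e) (T.hi e), (w (T.edgePoint e t) : ℂ) * h (T.edgePoint e t) := by
  have hwe : Measurable fun t => ENNReal.ofReal (w (T.edgePoint e t)) :=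
    (hw.1.comp (T.measurable_edgePoint e)).ennreal_ofReal
  rw [← setIntegral_eq_integral_of_forall_compl_eq_zero (s := {x | x.top = e.1}) h0,
    restrict_top_eq hw.1, integral_map (T.measurable_edgePoint e).aemeasurable
      hm.aestronglyMeasurable, integral_withDensity_eq_integral_toReal_smul hwe
      (Filter.Eventually.of_forall fun _ => ENNReal.ofReal_lt_top)]
  refine integral_congr_ae (Filter.Eventually.of_forall fun t => ?_)
  simp only
  rw [ENNReal.toReal_ofReal (hw.2 _).le, Complex.real_smul]

/-- A smooth function with compact support in an edge is a test function. -/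
theorem isTest_of_edge (bc : RootCondition) (e : T.Edge) {g : ℝ → ℝ} (hg : ContDiff ℝ 1 g)
    (hs : tsupport g ⊆ Ioo (T.lo e) (T.hi e)) :
    IsTest (T := T) bc (open Classical in fun x => if x.top = e.1 then (g x.abs : ℂ) else 0) := by
  classical
  have hlo : g (T.lo e) = 0 :=
    image_eq_zero_of_notMem_tsupport fun h => (lt_irrefl _ (hs h).1)
  have hhi : g (T.hi e) = 0 :=
    image_eq_zero_of_notMem_tsupport fun h => (lt_irrefl _ (hs h).2)
  refine ⟨fun f => ?_, ⟨{e}, finite_singleton e, fun x hx => ?_⟩, fun _ => ?_⟩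
  · rcases eq_or_ne f e with rfl | hf
    · refine (Complex.ofRealCLM.contDiff.comp hg).contDiffOn.congr fun t ht => ?_
      rcases ht.1.eq_or_lt with h | h
      · rw [edgePoint_of_le_lo f h.symm.le, Function.comp_apply, ← h, hlo, if_neg]
        · simp
        · intro h1
          have h1 : Order.pred f.1 = f.1 := h1
          have := T.gen_of_ne_bot f.1 f.2
          rw [h1] at this
          omega
      · obtain ⟨h1, h2⟩ := edgePoint_of_mem_Ioc f ⟨h, ht.2⟩
        rw [if_pos h1, h2]
        rfl
    · refine (contDiffOn_const (c := (0 : ℂ))).congr fun t ht => ?_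
      rcases ht.1.eq_or_lt with h | h
      · rw [edgePoint_of_le_lo f h.symm.le]
        split_ifs with h1
        · have h2 : (T.vertexPoint (Order.pred f.1)).abs = T.hi e := congrArg T.height h1
          rw [h2, hhi, Complex.ofReal_zero]
        · rfl
      · rw [if_neg]
        rw [(edgePoint_of_mem_Ioc f ⟨h, ht.2⟩).1]
        exact fun h => hf (Subtype.ext h)
  · have hx' := hx e rfl
    refine if_neg fun h => hx' ?_
    have h3 : T.lo e < x.abs := by
      rcases x.lt_abs with h4 | h4
      · rw [lo, ← h]; exact h4
      · exact absurd (h.symm.trans h4.1) e.2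
    have h4 : x.abs ≤ T.hi e := by rw [hi, ← h]; exact x.le_height
    obtain ⟨h5, h6⟩ := edgePoint_of_mem_Ioc e ⟨h3, h4⟩
    exact ⟨x.abs, ⟨h3.le, h4⟩, Point.ext (h5.trans h.symm) h6⟩
  · exact if_neg (Ne.symm e.2)

/-- The test functions are dense. -/
theorem eq_zero_of_forall_test {w : T.Point → ℝ} (hw : IsWeight w) {c : ℝ} (hwc : ∀ x, w x ≤ c)
    (bc : RootCondition) (f : L2 w)
    (h : ∀ u : T.Point → ℂ, IsTest bc u → ∀ p : L2 w, p =ᵐ[weighted w] u → inner ℂ p f = 0) :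
    f = 0 := by
  classical
  have hfm : Measurable f := (Lp.stronglyMeasurable f).measurable
  have hnorm := enorm_sq_eq_lintegral f (Filter.EventuallyEq.refl _ _)
  rw [lintegral_weighted hw.1 (hfm.enorm.pow_const 2)] at hnorm
  have hedge : ∀ e : T.Edge, ∫⁻ t in Ioo (T.lo e) (T.hi e),
      ‖f (T.edgePoint e t)‖ₑ ^ 2 * ENNReal.ofReal (w (T.edgePoint e t)) = 0 := by
    intro e
    have hfe := hfm.comp (T.measurable_edgePoint e)
    have hwe := hw.1.comp (T.measurable_edgePoint e)
    have hfin : ∫⁻ t in Ioo (T.lo e) (T.hi e),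
        ‖f (T.edgePoint e t)‖ₑ ^ 2 * ENNReal.ofReal (w (T.edgePoint e t)) < ⊤ := by
      refine (ENNReal.le_tsum (f := fun e => ∫⁻ t in Ioo (T.lo e) (T.hi e),
        ‖f (T.edgePoint e t)‖ₑ ^ 2 * ENNReal.ofReal (w (T.edgePoint e t))) e).trans_lt ?_
      rw [← hnorm]
      exact ENNReal.pow_lt_top enorm_lt_top
    -- From `|f| ≤ |f|² + 1` and `w ≤ c` one gets `w |f| ≤ w |f|² + c`, integrable on a bounded
    -- interval.
    have hint : IntegrableOn (fun t => (w (T.edgePoint e t) : ℂ) * f (T.edgePoint e t))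
        (Ioo (T.lo e) (T.hi e)) := by
      refine ⟨((Complex.measurable_ofReal.comp hwe).mul hfe).aestronglyMeasurable, ?_⟩
      have hb : ∫⁻ t in Ioo (T.lo e) (T.hi e), (‖f (T.edgePoint e t)‖ₑ ^ 2 *
          ENNReal.ofReal (w (T.edgePoint e t)) + ENNReal.ofReal c) < ⊤ := by
        rw [lintegral_add_right _ measurable_const, setLIntegral_const, Real.volume_Ioo]
        exact ENNReal.add_lt_top.mpr
          ⟨hfin, ENNReal.mul_lt_top ENNReal.ofReal_lt_top ENNReal.ofReal_lt_top⟩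
      refine lt_of_le_of_lt (lintegral_mono fun t => ?_) hb
      rw [enorm_mul]
      have h1 : ‖(w (T.edgePoint e t) : ℂ)‖ₑ = ENNReal.ofReal (w (T.edgePoint e t)) := by
        rw [← ofReal_norm, Complex.norm_real, Real.norm_of_nonneg (hw.2 _).le]
      rw [h1]
      set a := ‖f (T.edgePoint e t)‖ₑ
      have h2 : a ≤ a ^ 2 + 1 := by
        rcases le_total a 1 with ha | ha
        · exact ha.trans le_add_self
        · exact (le_self_pow₀ ha two_ne_zero).trans le_self_add
      calc _ ≤ ENNReal.ofReal (w (T.edgePoint e t)) * (a ^ 2 + 1) := by gcongr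
        _ = a ^ 2 * ENNReal.ofReal (w (T.edgePoint e t)) + ENNReal.ofReal (w (T.edgePoint e t)) := by
            ring
        _ ≤ _ := by
            gcongr
            exact hwc _
    -- Testing with smooth bumps inside the edge gives `w f = 0` almost everywhere there, and `w >
    -- 0`.
    have hae := isOpen_Ioo.ae_eq_zero_of_integral_contDiff_smul_eq_zero
      hint.locallyIntegrableOn fun g hg _ hgs => ?_
    · rw [lintegral_congr_ae (g := fun _ => 0), lintegral_zero]
      rw [Filter.EventuallyEq, ae_restrict_iff' measurableSet_Ioo]
      filter_upwards [hae] with t ht hmem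
      have h1 : (w (T.edgePoint e t) : ℂ) ≠ 0 := by
        exact_mod_cast (hw.2 (T.edgePoint e t)).ne'
      rw [(mul_eq_zero.mp (ht hmem)).resolve_left h1]
      simp
    · have hu := isTest_of_edge bc e (hg.of_le (by exact_mod_cast le_top)) hgs
      set u : T.Point → ℂ := fun x => if x.top = e.1 then (g x.abs : ℂ) else 0 with hudef
      have hmem := hu.memLp hw.1 hwc
      obtain ⟨p, hp⟩ : ∃ p : L2 w, p =ᵐ[weighted w] u := ⟨hmem.toLp, hmem.coeFn_toLp⟩
      have h1 := h u hu p hp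
      have h2 : (fun x => inner ℂ (p x) (f x)) =ᵐ[weighted w]
          fun x => f x * (starRingEnd ℂ) (u x) := by
        filter_upwards [hp] with x hx
        rw [hx, RCLike.inner_apply]
      have hm : Measurable fun x => f x * (starRingEnd ℂ) (u x) :=
        hfm.mul (Complex.continuous_conj.measurable.comp hu.measurable)
      rw [L2.inner_def, integral_congr_ae h2, integral_weighted_edge hw e hm] at h1
      · rw [← setIntegral_eq_integral_of_forall_compl_eq_zero (s := Ioo (T.lo e) (T.hi e)), ← h1]
        · refine setIntegral_congr_fun measurableSet_Ioo fun t ht => ?_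
          obtain ⟨h3, h4⟩ := edgePoint_of_mem_Ioc e (Ioo_subset_Ioc_edge e ht)
          simp only [hudef, h3, h4, if_true, Complex.conj_ofReal, Complex.real_smul]
          ring
        · intro t ht
          rw [image_eq_zero_of_notMem_tsupport fun h => ht (hgs h), zero_smul]
      · intro x hx
        simp [hudef, hx]
  simp only [hedge, tsum_zero] at hnorm
  have h3 : ‖f‖ₑ = 0 := by simpa using hnorm
  simpa using h3

theorem Comparable.exists_bounds {f g : T.Point → ℝ} (h : Comparable f g)
    (hg : ∀ x, 0 < g x) : ∃ c : ℝ, 0 < c ∧ ∀ x, f x ≤ c * g x ∧ g x ≤ c * f x := by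
  obtain ⟨c, hc, h⟩ := h
  refine ⟨c, hc, fun x => ⟨(div_le_iff₀ (hg x)).mp (h x).2, ?_⟩⟩
  have := (le_div_iff₀ (hg x)).mp (h x).1
  rwa [inv_mul_le_iff₀ hc] at this

/-- Growth passes from `ρ` to `ρβ` at the cost of one comparison constant at each of the two points;
`ρ < 1` supplies the upper bound. -/
theorem isGrowing_of_comparable {ρ ρβ : T.Point → ℝ} (hρ : IsWeight ρ) (hρ1 : ∀ x, ρ x < 1)
    (hβ : IsWeight ρβ) (hβs : IsSymmetric ρβ) (hβρ : Comparable ρβ ρ)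
    (hg : ∃ C : ℝ, 0 < C ∧ ∀ x y : T.Point, x.abs ≤ y.abs →
      C * (T.counting x.abs * ρ x) < T.counting y.abs * ρ y) :
    ∃ c K, IsGrowing ρβ c K := by
  obtain ⟨c, hc, hb⟩ := hβρ.exists_bounds hρ.2
  obtain ⟨C, hC, hg⟩ := hg
  refine ⟨c, c ^ 2 / C, hβ, hβs, fun x => ?_, by positivity, fun x y hxy => ?_⟩
  · exact (hb x).1.trans (mul_le_of_le_one_right hc.le (hρ1 x).le)
  · have h1 := hg x y hxy
    have hx : (0 : ℝ) ≤ T.counting x.abs := Nat.cast_nonneg _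
    have hy : (0 : ℝ) ≤ T.counting y.abs := Nat.cast_nonneg _
    have h2 := mul_le_mul_of_nonneg_left (hb x).1 hx
    have h3 := mul_le_mul_of_nonneg_left (hb y).2 hy
    rw [div_mul_eq_mul_div, le_div_iff₀ hC]
    calc _ ≤ T.counting x.abs * (c * ρ x) * C := by gcongr
      _ = c * (C * (T.counting x.abs * ρ x)) := by ring
      _ ≤ c * (T.counting y.abs * (c * ρβ y)) :=
          mul_le_mul_of_nonneg_left (h1.le.trans h3) hc.le
      _ = _ := by ring

/-! ### The form domain as a Hilbert space, and its embedding. -/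

/-- `H^1_0` as a subspace of the Hilbert sum `L_2 ⊕ L_2`. -/
def H10' (bc : RootCondition) (ρ : T.Point → ℝ) : Submodule ℂ (WithLp 2 (L2 ρ × L2 ρ)) :=
  (H10 bc ρ).comap (WithLp.linearEquiv 2 ℂ (L2 ρ × L2 ρ)).toLinearMap

theorem mem_H10' {bc : RootCondition} {ρ : T.Point → ℝ} {p : WithLp 2 (L2 ρ × L2 ρ)} :
    p ∈ H10' bc ρ ↔ WithLp.ofLp p ∈ H10 bc ρ := Iff.rfl

/-- The plain product carries the sup norm, `WithLp 2` the Hilbert norm; they have the same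
topology, hence the same closed sets. -/
theorem isClosed_H10' (bc : RootCondition) (ρ : T.Point → ℝ) :
    IsClosed (H10' bc ρ : Set (WithLp 2 (L2 ρ × L2 ρ))) :=
  (Submodule.isClosed_topologicalClosure _).preimage (WithLp.prod_continuous_ofLp 2 _ _)

instance completeSpace_H10' (bc : RootCondition) (ρ : T.Point → ℝ) :
    CompleteSpace (H10' bc ρ) := (isClosed_H10' bc ρ).completeSpace_coe

/-- The embedding of `H^1_0` into `L_2`. -/
def embed (bc : RootCondition) (ρ : T.Point → ℝ) : H10' bc ρ →L[ℂ] L2 ρ :=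
  ContinuousLinearMap.fst ℂ (L2 ρ) (L2 ρ) ∘L
    (WithLp.prodContinuousLinearEquiv 2 ℂ (L2 ρ) (L2 ρ) : _ →L[ℂ] L2 ρ × L2 ρ) ∘L
      (H10' bc ρ).subtypeL

theorem embed_apply {bc : RootCondition} {ρ : T.Point → ℝ} (p : H10' bc ρ) :
    embed bc ρ p = (WithLp.ofLp p.1).1 := rfl

/-- Stated through the orthogonal projection onto `F`, the estimate for test functions is a closed
condition on the pair `(u, u')`, so it extends from the pairs of test functions to their closure. -/
theorem isCompactOperator_embed [Infinite T.Vertex] (hT : T.IsRadial) {R : ℝ}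
    (hR : ∀ v, T.height v < R) {w : T.Point → ℝ} {c K : ℝ} (hw : IsGrowing w c K)
    (bc : RootCondition) : IsCompactOperator (embed bc w) := by
  refine isCompactOperator_of_finiteDimensional_approx _ fun ε hε => ?_
  obtain ⟨F, hF, h⟩ := exists_finiteDimensional_approx hT hR hw bc hε
  refine ⟨F, hF, fun p => ⟨F.starProjection (embed bc w p), Submodule.starProjection_apply_mem _ _,
    ?_⟩⟩
  set C : Set (L2 w × L2 w) := {p | ‖p.1 - F.starProjection p.1‖ ≤ ε * ‖p.2‖}
  have hC : IsClosed C := isClosed_le (by fun_prop) (by fun_prop)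
  have hsub : (H10 bc w : Set (L2 w × L2 w)) ⊆ C := by
    refine closure_minimal ?_ hC
    intro q hq
    obtain ⟨u, hu, h1, h2⟩ := (Set.ext_iff.mp (span_test hw.weight.1 bc) q).mp hq
    obtain ⟨f, hf, hfq⟩ := h u hu q.1 q.2 h1 h2
    refine le_trans ?_ hfq
    rw [F.starProjection_minimal]
    exact ciInf_le ⟨0, by rintro _ ⟨x, rfl⟩; exact norm_nonneg _⟩ (⟨f, hf⟩ : F)
  have hp : ‖embed bc w p - F.starProjection (embed bc w p)‖ ≤ ε * ‖(WithLp.ofLp p.1).2‖ :=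
    hsub (mem_H10'.mp p.2)
  refine hp.trans ?_
  gcongr
  have h1 := WithLp.prod_norm_sq_eq_of_L2 p.1
  refine le_of_sq_le_sq ?_ (norm_nonneg _)
  change ‖(p.1).snd‖ ^ 2 ≤ ‖p.1‖ ^ 2
  rw [h1]
  exact le_add_of_nonneg_left (sq_nonneg _)

theorem denseRange_embed {w : T.Point → ℝ} (hw : IsWeight w) {c : ℝ} (hwc : ∀ x, w x ≤ c)
    (bc : RootCondition) : DenseRange (embed bc w) := by
  have h : Dense ((embed bc w).range : Set (L2 w)) := by
    rw [Submodule.dense_iff_topologicalClosure_eq_top, Submodule.topologicalClosure_eq_top_iff,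
      Submodule.eq_bot_iff]
    intro f hf
    refine eq_zero_of_forall_test hw hwc bc f fun u hu p hp => ?_
    have hm := hu.memLp_edgeDeriv hw.1 hwc
    have hmem : ((p, hm.toLp) : L2 w × L2 w) ∈ H10 bc w :=
      Submodule.le_topologicalClosure _ (Submodule.subset_span ⟨u, hu, hp, hm.coeFn_toLp⟩)
    exact hf _ ⟨⟨WithLp.toLp 2 (p, hm.toLp), hmem⟩, rfl⟩
  exact h

end MetricTree

end

/-! ### The form `E` and its operator. -/

theorem mainTheorem6 (T : MetricTree) [Infinite T.Vertex] (hrad : T.IsRadial)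
    (hR : T.radius < ⊤) (bc : MetricTree.RootCondition)
    (ρ ρα ρβ W : T.Point → ℝ)
    (hρ : MetricTree.IsWeight ρ) (hρ1 : ∀ x, ρ x < 1) (hρs : MetricTree.IsSymmetric ρ)
    (hα : MetricTree.IsWeight ρα) (hαs : MetricTree.IsSymmetric ρα)
    (hαρ : MetricTree.Comparable ρα ρ)
    (hβ : MetricTree.IsWeight ρβ) (hβs : MetricTree.IsSymmetric ρβ)
    (hβρ : MetricTree.Comparable ρβ ρ)
    (hW : MemLp W ⊤ T.lengthMeasure)
    (hg : ∃ C : ℝ, 0 < C ∧ ∀ x y : T.Point, x.abs ≤ y.abs →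
      C * (T.counting x.abs * ρ x) < T.counting y.abs * ρ y) :
    ∃ A : MetricTree.L2 ρβ →ₗ.[ℂ] MetricTree.L2 ρβ,
      MetricTree.IsWidthWeightedOperator bc ρα ρβ W A ∧
      IsSelfAdjoint A ∧ UnboundedOperator.HasPurelyDiscreteSpectrum A := by
  obtain ⟨c, K, hw⟩ := MetricTree.isGrowing_of_comparable hρ hρ1 hβ hβs hβρ hg
  -- Any `R` strictly above all heights serves in the Hardy inequality; adding 1 gives strictness at
  -- once.
  have hR' : ∀ v, T.height v < T.radius.toReal + 1 := fun v =>
    (MetricTree.height_le_radius hR v).trans_lt (lt_add_one _)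
  obtain ⟨a, ha, hab⟩ := hαρ.exists_bounds hρ.2
  obtain ⟨b, hb, hbb⟩ := hβρ.exists_bounds hρ.2
  have hub : ∀ x, ρα x / ρβ x ≤ a * b := by
    intro x
    rw [div_le_iff₀ (hβ.2 x)]
    calc _ ≤ a * ρ x := (hab x).1
      _ ≤ a * (b * ρβ x) := by
          gcongr
          exact (hbb x).2
      _ = _ := by ring
  have hlb : ∀ x, (a * b)⁻¹ ≤ ρα x / ρβ x := by
    intro x
    rw [le_div_iff₀ (hβ.2 x), inv_mul_le_iff₀ (by positivity)]
    calc _ ≤ b * ρ x := (hbb x).1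
      _ ≤ b * (a * ρα x) := by
          gcongr
          exact (hab x).2
      _ = _ := by ring
  have hm : MemLp (fun x => ρα x / ρβ x) ⊤ (MetricTree.weighted ρβ) := by
    refine memLp_top_of_bound (hα.1.div hβ.1).aestronglyMeasurable (a * b)
      (Filter.Eventually.of_forall fun x => ?_)
    rw [Real.norm_of_nonneg (div_pos (hα.2 x) (hβ.2 x)).le]
    exact hub x
  have hW' : MemLp W ⊤ (MetricTree.weighted ρβ) := by
    have hac : MetricTree.weighted ρβ ≪ T.lengthMeasure := withDensity_absolutelyContinuous _ _
    refine ⟨hW.1.mono_ac hac, lt_of_le_of_lt ?_ hW.2⟩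
    rw [eLpNorm_exponent_top, eLpNorm_exponent_top]
    exact eLpNormEssSup_mono_measure W hac
  obtain ⟨M, hM⟩ := exists_mul_operator hm
  obtain ⟨N, hN⟩ := exists_mul_operator hW'
  set V := MetricTree.H10' bc ρβ
  let e := WithLp.prodContinuousLinearEquiv 2 ℂ (MetricTree.L2 ρβ) (MetricTree.L2 ρβ)
  let B₀ : WithLp 2 (MetricTree.L2 ρβ × MetricTree.L2 ρβ) →L[ℂ]
      WithLp 2 (MetricTree.L2 ρβ × MetricTree.L2 ρβ) :=
    (e.symm : _ →L[ℂ] _) ∘L (N.prodMap M) ∘L (e : _ →L[ℂ] _)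
  -- The diagonal operator multiplying `u` by `W` and `u'` by `ρα / ρβ` need not preserve `V`; its
  -- compression to `V` represents `E` there.
  let B : V →L[ℂ] V := V.orthogonalProjectionOnto ∘L B₀ ∘L V.subtypeL
  have hBin : ∀ p q : V, inner ℂ q (B p) =
      inner ℂ (WithLp.ofLp q.1).1 (N (WithLp.ofLp p.1).1) +
      inner ℂ (WithLp.ofLp q.1).2 (M (WithLp.ofLp p.1).2) := by
    intro p q
    have h1 : inner ℂ q (B p) = inner ℂ (q : WithLp 2 (MetricTree.L2 ρβ × MetricTree.L2 ρβ))
        (B₀ p.1) := V.inner_orthogonalProjectionOnto_eq_of_mem_left q (B₀ p.1)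
    rw [h1, WithLp.prod_inner_apply]
    rfl
  have hBform : ∀ p q : V, inner ℂ q (B p) =
      MetricTree.form ρα ρβ W (WithLp.ofLp p.1) (WithLp.ofLp q.1) := by
    intro p q
    obtain ⟨h1, h2⟩ := inner_mul_operator hM (WithLp.ofLp q.1).2 (WithLp.ofLp p.1).2
    obtain ⟨h3, h4⟩ := inner_mul_operator hN (WithLp.ofLp q.1).1 (WithLp.ofLp p.1).1
    rw [hBin, h2, h4, MetricTree.form, integral_add h1 h3, add_comm]
  have hBs : ∀ p q : V, inner ℂ (B p) q = inner ℂ p (B q) := by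
    intro p q
    rw [← inner_conj_symm (𝕜 := ℂ) (B p) q, hBin, hBin, map_add,
      inner_conj_symm (𝕜 := ℂ) (N (WithLp.ofLp p.1).1),
      inner_conj_symm (𝕜 := ℂ) (M (WithLp.ofLp p.1).2), mul_operator_symm hM, mul_operator_symm hN]
  -- The derivative part is at least `(a * b)⁻¹ ‖u'‖²`. In the shift, `‖N‖` compensates the
  -- potential and `(a * b)⁻¹` supplies the missing `‖u‖²` of the norm.
  have hcoer : ∀ p : V, (a * b)⁻¹ * ‖p‖ ^ 2 ≤ (inner ℂ p (B p)).re +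
      (‖N‖ + (a * b)⁻¹) * ‖MetricTree.embed bc ρβ p‖ ^ 2 := by
    intro p
    rw [hBin, Complex.add_re, MetricTree.embed_apply]
    have h1 := mul_norm_sq_le_inner hM hlb (WithLp.ofLp p.1).2
    have h2 : -(‖N‖ * ‖(WithLp.ofLp p.1).1‖ ^ 2) ≤
        (inner ℂ (WithLp.ofLp p.1).1 (N (WithLp.ofLp p.1).1)).re := by
      have h3 := (abs_le.mp ((Complex.abs_re_le_norm
        (inner ℂ (WithLp.ofLp p.1).1 (N (WithLp.ofLp p.1).1))).trans
          (norm_inner_le_norm _ _))).1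
      have h4 := N.le_opNorm (WithLp.ofLp p.1).1
      have h5 := norm_nonneg (WithLp.ofLp p.1).1
      nlinarith
    have h3 : ‖p‖ ^ 2 = ‖(WithLp.ofLp p.1).1‖ ^ 2 + ‖(WithLp.ofLp p.1).2‖ ^ 2 :=
      WithLp.prod_norm_sq_eq_of_L2 p.1
    rw [h3]
    linarith
  obtain ⟨A, hA, hsa, hds⟩ := exists_operator_of_form (MetricTree.embed bc ρβ)
    (MetricTree.denseRange_embed hβ hw.le bc)
    (MetricTree.isCompactOperator_embed hrad hR' hw bc) B hBs (by positivity) _ hcoer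
  refine ⟨A, fun u f => ?_, hsa, hds⟩
  rw [hA]
  constructor
  · rintro ⟨p, rfl, hp⟩
    refine ⟨WithLp.ofLp p.1, p.2, rfl, fun q hq => ?_⟩
    have := hp ⟨WithLp.toLp 2 q, hq⟩
    rwa [hBform] at this
  · rintro ⟨p, hp, rfl, h⟩
    refine ⟨⟨WithLp.toLp 2 p, hp⟩, rfl, fun q => ?_⟩
    rw [hBform]
    exact h _ q.2
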